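/- Let $d\ge 1$ be an integer, $a>0$, $b\in\mathbb R$, $\beta\in(0,1]$. On $\mathbb T^d=[0,2\pi]^d$ with the normalized Lebesgue measure let $L_p$ ($1\le p<\infty$) be the usual space of complex-valued functions. For $\mathbf s\in\mathbb N_0^d$ put $\|\mathbf s\|_1=s_1+\dots+s_d$ and $$\rho(\mathbf s)=\{\mathbf k\in\mathbb Z^d:\ \lfloor 2^{s_j-1}\rfloor\le|k_j|<2^{s_j},\ j=1,\dots,d\}.$$ Let $\mathbf H^{a,b}_{A_\beta}=\mathbf H^{a,b}_{A_\beta}(\mathcal T^d)$ be the class of all functions $f$ on $\mathbb T^d$ that have a representation $f(\mathbf x)=\sum_{\mathbf k\in\mathbb Z^d}a_{\mathbf k}e^{i(\mathbf k,\mathbf x)}$ with $\sum_{\mathbf k}|a_{\mathbf k}|<\infty$ and $$\Big(\sum_{\mathbf k\in\rho(\mathbf s)}|a_{\mathbf k}|^\beta\Big)^{1/\beta}\le 2^{-a\|\mathbf s\|_1}\max(\|\mathbf s\|_1,1)^{(d-1)b}\qquad\text{for all }\mathbf s\in\mathbb N_0^d.$$ For a class $W$ of continuous functions let $$\varrho^o_m(W,L_p)=\inf_{\xi^1,\dots,\xi^m\in\mathbb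 T^d}\ \inf_{\mathcal M:\mathbb C^m\to L_p}\ \sup_{f\in W}\|f-\mathcal M(f(\xi^1),\dots,f(\xi^m))\|_p,$$ where $\mathcal M$ ranges over all (not necessarily linear) mappings. (i) There is a constant $c=c(d,a,b,\beta)>0$ such that for all integers $m\ge2$ $$\varrho^o_m(\mathbf H^{a,b}_{A_\beta},L_1)\ \ge\ c\,m^{1/2-1/\beta-a}(\log m)^{(d-1)(b+1)};$$ if $(d-1)(b+1)\ge0$, this also holds for $m=1$, with $0^0=1$. (ii) Consequently, by known upper bounds, the power decay of $\varrho^o_m(\mathbf H^{a,b}_{A_\beta},L_p)$ is $m^{1/2-1/\beta-a}$, up to logarithmic factors, for every $p\in[1,2]$: there are constants $c,C>0$ and $K\in\mathbb R$, depending only on $d,a,b,\beta$, such that for all $p\in[1,2]$ and all integers $m\ge2$ $$c\,m^{1/2-1/\beta-a}(\log m)^{(d-1)(b+1)}\ \le\ \varrho^o_m(\mathbf H^{a,b}_{A_\beta},L_p)\ \le\ C\,m^{1/2-1/\beta-a}(\log m)^{K}.$$ -/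

import Mathlib

open MeasureTheory
open scoped ENNReal

noncomputable section

namespace SamplingRecovery

/-- The optimal (nonlinear) sampling recovery characteristic of a class `W` of functions on `Ω`,
in the norm of `L_p(Ω, μ)`, with values in `[0, ∞]`: the points `ξ` range over all `m`-tuples in
`Ω` and `M` ranges over all mappings from `ℂ ^ m` to `L_p`. Repetitions among the points
are allowed; on an infinite `Ω` this does not change the infimum, because a mapping may ignore
some of its arguments. -/
def optimalRecovery {X : Type*} [MeasurableSpace X] (Ω : Set X) (μ : Measure X)
    (m : ℕ) (W : Set (X → ℂ)) (p : ℝ≥0∞) : ℝ≥0∞ :=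
  ⨅ (ξ : Fin m → Ω) (M : (Fin m → ℂ) → Lp ℂ p μ),
    ⨆ f ∈ W, eLpNorm (fun x => f x - M (fun i => f (ξ i)) x) p μ

/-- The dyadic block `ρ(s)`: all `k ∈ ℤ ^ d` with `[2 ^ (s_j - 1)] ≤ |k_j| < 2 ^ s_j` for all `j`
(here `Ioo` expresses `|k_j| < 2 ^ s_j`). -/
def dyadicBlock {d : ℕ} (s : Fin d → ℕ) : Finset (Fin d → ℤ) :=
  Fintype.piFinset fun j =>
    (Finset.Ioo (-(2 : ℤ) ^ s j) ((2 : ℤ) ^ s j)).filter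
      fun n => ⌊(2 : ℝ) ^ ((s j : ℤ) - 1)⌋ ≤ |n|

/-- The `A_β` quasi-norm `(∑ |c_k| ^ β) ^ (1 / β)` of the part, with frequencies in the finite
set `S`, of a series with coefficients `c`. -/
def quasiNormA {d : ℕ} (β : ℝ) (c : (Fin d → ℤ) → ℂ) (S : Finset (Fin d → ℤ)) : ℝ :=
  (∑ k ∈ S, ‖c k‖ ^ β) ^ (1 / β)

/-- The class `H^{a,b}_{A_β}(Ψ)` for a system `Ψ` of functions on `Ω` indexed by `ℤ ^ d`: the
functions having on `Ω` an absolutely convergent representation `f = ∑ c_k ψ_k` such that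
`|δ_s(f, Ψ)|_{A_β} ≤ 2 ^ (-a j) * max(j, 1) ^ ((d - 1) b)` with `j = ‖s‖₁`, for all `s`. -/
def classH {X : Type*} {d : ℕ} (Ω : Set X) (Ψ : (Fin d → ℤ) → X → ℂ) (a b β : ℝ) :
    Set (X → ℂ) :=
  {f | ∃ c : (Fin d → ℤ) → ℂ, Summable (fun k => ‖c k‖) ∧
    (∀ x ∈ Ω, HasSum (fun k => c k * Ψ k x) (f x)) ∧
    ∀ s : Fin d → ℕ, quasiNormA β c (dyadicBlock s) ≤
      (2 : ℝ) ^ (-a * ((∑ j, s j : ℕ) : ℝ)) *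
        ((max (∑ j, s j) 1 : ℕ) : ℝ) ^ (((d : ℝ) - 1) * b)}

/-- The cube `[0, 2π] ^ d`. -/
def torus (d : ℕ) : Set (Fin d → ℝ) :=
  Set.Icc 0 (fun _ => 2 * Real.pi)

/-- The normalized Lebesgue measure `(2π) ^ (-d) dx` on the cube `[0, 2π] ^ d`. -/
def torusMeasure (d : ℕ) : Measure (Fin d → ℝ) :=
  ENNReal.ofReal (((2 * Real.pi) ^ d)⁻¹) • volume.restrict (torus d)

/-- The trigonometric system `e ^ (i (k, x))`, `k ∈ ℤ ^ d`. -/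
def trigSystem (d : ℕ) (k : Fin d → ℤ) (x : Fin d → ℝ) : ℂ :=
  Complex.exp (Complex.I * ∑ j, (k j : ℂ) * (x j : ℂ))

/-- The characteristic of optimal recovery of `H^{a,b}_{A_β}` for the trigonometric system in
`L_p` of the torus. -/
def recoveryH (d : ℕ) (a b β : ℝ) (m : ℕ) (p : ℝ≥0∞) : ℝ≥0∞ :=
  optimalRecovery (torus d) (torusMeasure d) m (classH (torus d) (trigSystem d) a b β) p

end SamplingRecovery

end

namespace SamplingRecovery
open Finset

/-! Write δ = a + 1/β - 1/2; at dyadic level n, with 2^n comparable to m up to logarithms, both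
bounds have size 2^(-δn).

Lower bound. If `F` and `-F` lie in the class and vanish at all sample points, every recovery map
errs by at least the norm of `F` on one of them. For each `s` with ‖s‖₁ = n, the polynomials with
frequencies in the box ∏ [0, 2^(s_j)) that vanish at the points form a space of dimension at least
half of 2^n. The normalized diagonal of its reproducing kernel lies in [0, 1], vanishes at the
points and has mean at least 1/2. Adding these functions over all such `s` makes the mean grow like
n^(d-1), while a block of level j meets only polynomially many (in n - j) summands. The gap
2^(δ(n-j)) absorbs that factor, so a multiple of order 2^(-δn) n^((d-1)b) lies in the class
(`exists_fooling_coeffs`, `exists_lower_bound`).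

Upper bound. It suffices to bound f - g in L_2 when f and g in the class agree at well-chosen
points. The tool is `exists_norming_points`: about 4^L points, up to logarithms, such that a
polynomial with unit ℓ_2 norm and ℓ_1 norm at most 2^L of its coefficients has modulus at least 1/4
at one of them. Polynomials are replaced by short averages of signed exponentials (Maurey). These
are finitely many, so a greedy choice of points hits all their large level sets. The coefficients of
f - g consist of about 2^n low ones and a part small in ℓ_β, so the ℓ_1 norm is at most about
2^(n/2) times the ℓ_2 norm plus a remainder (`sum_le_sqrt_mul_add`). Either the ℓ_2 norm is already
of the desired size, or the norming property applies and bounds it by the value at a sample point,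
which is only the truncation error (`sqrt_sum_sq_le`). -/

/-! ### Greedy hitting sets and an empirical approximation lemma -/

theorem exists_hitting_finset {G α : Type*} [Fintype G] [Nonempty G] [DecidableEq G]
    (F : Finset α) (S : α → Finset G) {p : ℝ} (hp1 : p ≤ 1)
    (h : ∀ a ∈ F, p * Fintype.card G ≤ #(S a)) (m : ℕ) :
    ∃ P : Finset G, #P ≤ m ∧ (#{a ∈ F | Disjoint (S a) P} : ℝ) ≤ (1 - p) ^ m * #F := by
  induction m with
  | zero => exact ⟨∅, by simp, by simp⟩
  | succ m ih =>
    obtain ⟨P, hPm, hP⟩ := ih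
    set F' := {a ∈ F | Disjoint (S a) P} with hF'
    have hsum : ∑ x : G, (#{a ∈ F' | x ∈ S a} : ℝ) = ∑ a ∈ F', (#(S a) : ℝ) := by
      have := Finset.sum_card_bipartiteAbove_eq_sum_card_bipartiteBelow
        (s := (univ : Finset G)) (t := F') (fun x a => x ∈ S a)
      simp only [bipartiteAbove, bipartiteBelow, filter_mem_eq_inter, univ_inter] at this
      exact_mod_cast this
    have hlow : ∑ _x : G, p * (#F' : ℝ) ≤ ∑ x : G, (#{a ∈ F' | x ∈ S a} : ℝ) := by
      rw [hsum]
      calc ∑ _x : G, p * (#F' : ℝ) = ∑ a ∈ F', p * (Fintype.card G : ℝ) := by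
            simp; ring
        _ ≤ _ := Finset.sum_le_sum fun a ha => h a (Finset.mem_filter.1 ha).1
    -- Greedy choice: on average a point lies in a fraction `p` of the sets not yet hit, so some
    -- point hits at least that many.
    obtain ⟨x, -, hx⟩ := Finset.exists_le_of_sum_le univ_nonempty hlow
    refine ⟨insert x P, (card_insert_le _ _).trans (by omega), ?_⟩
    have hsplit : #{a ∈ F | Disjoint (S a) (insert x P)} + #{a ∈ F' | x ∈ S a} = #F' := by
      rw [← Finset.card_filter_add_card_filter_not (s := F') (fun a => x ∈ S a), add_comm]
      congr 2
      rw [hF', filter_filter]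
      refine filter_congr fun a _ => ?_
      rw [disjoint_insert_right]; tauto
    have hsplit' : (#{a ∈ F | Disjoint (S a) (insert x P)} : ℝ) + #{a ∈ F' | x ∈ S a} = #F' := by
      exact_mod_cast hsplit
    have : (1 - p) * (#F' : ℝ) ≤ (1 - p) * ((1 - p) ^ m * #F) :=
      mul_le_mul_of_nonneg_left hP (by linarith)
    rw [pow_succ]
    nlinarith

/-- The exponential lies below its chord. The bound is affine in `y`, so averaging over a centred
variable leaves only cosh(2l), as in Hoeffding's inequality. -/
theorem exp_mul_le_of_abs_le {l y : ℝ} (hy : |y| ≤ 2) :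
    Real.exp (l * y) ≤ Real.cosh (2 * l) + y / 2 * Real.sinh (2 * l) := by
  obtain ⟨h1, h2⟩ := abs_le.1 hy
  have := convexOn_exp.2 (Set.mem_univ (2 * l)) (Set.mem_univ (-(2 * l)))
    (show 0 ≤ (2 + y) / 4 by linarith) (show 0 ≤ (2 - y) / 4 by linarith) (by ring)
  simp only [smul_eq_mul] at this
  rw [Real.cosh_eq, Real.sinh_eq]
  calc _ = Real.exp ((2 + y) / 4 * (2 * l) + (2 - y) / 4 * -(2 * l)) := by congr 1; ring
    _ ≤ _ := this
    _ = _ := by ring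

/-- A one-sided Maurey lemma in the uniform norm over a finite set. -/
theorem exists_empirical_le {A Y : Type*} [Fintype A] [Fintype Y] (w : A → ℝ)
    (hw : ∀ a, 0 ≤ w a) (hw1 : ∑ a, w a = 1) (f : A → Y → ℝ) (hf : ∀ a y, |f a y| ≤ 1)
    (l : ℝ) (M : ℕ) :
    ∃ t : Fin M → A, ∑ y, Real.exp (l * ∑ j, (f (t j) y - ∑ a, w a * f a y)) ≤
      Fintype.card Y * Real.exp (2 * l ^ 2 * M) := by
  induction M with
  | zero => exact ⟨Fin.elim0, by simp⟩
  | succ M ih =>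
    obtain ⟨t, ht⟩ := ih
    set μ : Y → ℝ := fun y => ∑ a, w a * f a y with hμ
    set E : Y → ℝ := fun y => Real.exp (l * ∑ j, (f (t j) y - μ y)) with hE
    have hμ1 : ∀ y, |μ y| ≤ 1 := fun y => by
      refine (abs_sum_le_sum_abs _ _).trans ?_
      rw [← hw1]
      refine sum_le_sum fun a _ => ?_
      rw [abs_mul, abs_of_nonneg (hw a)]
      exact mul_le_of_le_one_right (hw a) (hf a y)
    have havg : ∀ y, ∑ a, w a * Real.exp (l * (f a y - μ y)) ≤ Real.exp (2 * l ^ 2) := fun y => by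
      calc _ ≤ ∑ a, w a * (Real.cosh (2 * l) + (f a y - μ y) / 2 * Real.sinh (2 * l)) := by
            refine sum_le_sum fun a _ => mul_le_mul_of_nonneg_left (exp_mul_le_of_abs_le ?_) (hw a)
            exact (abs_sub _ _).trans (by linarith [hf a y, hμ1 y])
        _ = Real.cosh (2 * l) * ∑ a, w a +
            ((∑ a, w a * f a y) - (∑ a, w a) * μ y) / 2 * Real.sinh (2 * l) := by
            rw [mul_sum, sum_mul, ← sum_sub_distrib, sum_div, sum_mul, ← sum_add_distrib]
            exact sum_congr rfl fun a _ => by ring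
        _ = Real.cosh (2 * l) := by rw [hw1]; simp [hμ]
        _ ≤ Real.exp ((2 * l) ^ 2 / 2) := Real.cosh_le_exp_half_sq _
        _ = _ := by congr 1; ring
    have hE0 : ∀ y, 0 ≤ E y := fun y => (Real.exp_pos _).le
    -- Derandomized sampling: the `w`-average of the updated potential is at most exp(2l²) times the
    -- old one, so some single `a` does no worse.
    have hex : ∃ a, ∑ y, E y * Real.exp (l * (f a y - μ y)) ≤
        Real.exp (2 * l ^ 2) * ∑ y, E y := by
      by_contra! hcon
      have h1 : ∑ a, w a * (Real.exp (2 * l ^ 2) * ∑ y, E y) <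
          ∑ a, w a * ∑ y, E y * Real.exp (l * (f a y - μ y)) := by
        refine sum_lt_sum (fun a _ => mul_le_mul_of_nonneg_left (hcon a).le (hw a)) ?_
        obtain ⟨a, -, ha⟩ := exists_ne_zero_of_sum_ne_zero (hw1.trans_ne one_ne_zero)
        exact ⟨a, mem_univ _, mul_lt_mul_of_pos_left (hcon a) ((hw a).lt_of_ne' ha)⟩
      rw [← sum_mul, hw1, one_mul] at h1
      refine absurd h1 (not_lt.2 ?_)
      calc _ = ∑ y, E y * ∑ a, w a * Real.exp (l * (f a y - μ y)) := by
            simp_rw [mul_sum]; rw [sum_comm]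
            exact sum_congr rfl fun _ _ => sum_congr rfl fun _ _ => by ring
        _ ≤ ∑ y, E y * Real.exp (2 * l ^ 2) :=
            sum_le_sum fun y _ => mul_le_mul_of_nonneg_left (havg y) (hE0 y)
        _ = _ := by rw [← sum_mul]; ring
    obtain ⟨a, ha⟩ := hex
    refine ⟨Fin.snoc t a, ?_⟩
    calc _ = ∑ y, E y * Real.exp (l * (f a y - μ y)) := by
          refine sum_congr rfl fun y _ => ?_
          rw [hE, ← Real.exp_add, Fin.sum_univ_castSucc]
          simp only [Fin.snoc_castSucc, Fin.snoc_last]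
          congr 1; simp only [hμ]; ring
      _ ≤ Real.exp (2 * l ^ 2) * ∑ y, E y := ha
      _ ≤ Real.exp (2 * l ^ 2) * (Fintype.card Y * Real.exp (2 * l ^ 2 * M)) :=
          mul_le_mul_of_nonneg_left ht (Real.exp_pos _).le
      _ = Fintype.card Y * (Real.exp (2 * l ^ 2) * Real.exp (2 * l ^ 2 * M)) := by ring
      _ = _ := by
          rw [← Real.exp_add]; push_cast; congr 2; ring

/-! ### Approximation by short averages of atoms -/

/-- The functions `i ^ r e_k`, together with zero. -/
def atom {ι G : Type*} (e : ι → G → ℂ) : Option (ι × Fin 4) → G → ℂ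
  | none, _ => 0
  | some (k, r), x => Complex.I ^ (r : ℕ) * e k x

theorem norm_atom_le {ι G : Type*} {e : ι → G → ℂ} (he : ∀ k x, ‖e k x‖ ≤ 1)
    (a : Option (ι × Fin 4)) (x : G) : ‖atom e a x‖ ≤ 1 := by
  rcases a with _ | ⟨k, r⟩
  · simp [atom]
  · simpa [atom] using he k x

/-- The weights of the atoms in the representation of `∑ c_k e_k / (2 T)`. -/
noncomputable def atomWeight {ι : Type*} [Fintype ι] (c : ι → ℂ) (T : ℝ) : Option (ι × Fin 4) → ℝ
  | none => 1 - (∑ k, (|(c k).re| + |(c k).im|)) / (2 * T)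
  | some (k, r) => ![max (c k).re 0, max (c k).im 0, max (-(c k).re) 0, max (-(c k).im) 0] r /
      (2 * T)

theorem sum_atomWeight {ι : Type*} [Fintype ι] (c : ι → ℂ) (T : ℝ) :
    ∑ a, atomWeight c T a = 1 := by
  have habs : ∀ z : ℝ, |z| = max z 0 + max (-z) 0 := fun z => by
    rcases le_total 0 z with h | h
    · rw [abs_of_nonneg h, max_eq_left h, max_eq_right (by linarith)]; ring
    · rw [abs_of_nonpos h, max_eq_right h, max_eq_left (by linarith)]; ring
  rw [Fintype.sum_option, Fintype.sum_prod_type, atomWeight, sum_div, sub_add_eq_add_sub,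
    add_sub_assoc, ← sum_sub_distrib, sum_eq_zero, add_zero]
  intro k _
  simp only [atomWeight, Fin.sum_univ_four]
  simp
  rw [habs (c k).re, habs (c k).im]
  ring

/-- Splitting a coefficient into positive and negative real and imaginary parts costs |Re| + |Im| ≤
2|c_k|. Hence the normalization by 2T; the zero atom receives the leftover weight. -/
theorem atomWeight_nonneg {ι : Type*} [Fintype ι] {c : ι → ℂ} {T : ℝ} (hT : 0 < T)
    (hc : ∑ k, ‖c k‖ ≤ T) (a : Option (ι × Fin 4)) : 0 ≤ atomWeight c T a := by
  rcases a with _ | ⟨k, r⟩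
  · rw [atomWeight, sub_nonneg, div_le_one (by positivity)]
    calc ∑ k, (|(c k).re| + |(c k).im|) ≤ ∑ k, 2 * ‖c k‖ := sum_le_sum fun k _ => by
          linarith [Complex.abs_re_le_norm (c k), Complex.abs_im_le_norm (c k)]
      _ ≤ 2 * T := by rw [← mul_sum]; linarith
  · rw [atomWeight]
    refine div_nonneg ?_ (by positivity)
    fin_cases r <;> simp

theorem sum_atomWeight_mul_atom {ι G : Type*} [Fintype ι] (e : ι → G → ℂ) (c : ι → ℂ) {T : ℝ}
    (x : G) :
    ∑ a, (atomWeight c T a : ℂ) * atom e a x = (∑ k, c k * e k x) / (2 * T) := by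
  have hmax : ∀ z : ℝ, ((max z 0 : ℝ) : ℂ) - ((max (-z) 0 : ℝ) : ℂ) = z := fun z => by
    rcases le_total 0 z with h | h
    · rw [max_eq_left h, max_eq_right (by linarith)]; simp
    · rw [max_eq_right h, max_eq_left (by linarith)]; simp
  rw [Fintype.sum_option, Fintype.sum_prod_type, sum_div]
  simp only [atom, mul_zero, zero_add]
  refine sum_congr rfl fun k _ => ?_
  simp only [atomWeight, Fin.sum_univ_four]
  have h3 : ((3 : Fin 4) : ℕ) = 3 := rfl
  have h2 : ((2 : Fin 4) : ℕ) = 2 := rfl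
  have h1 : ((1 : Fin 4) : ℕ) = 1 := rfl
  have hI : Complex.I ^ 3 = -Complex.I := by rw [pow_succ, Complex.I_sq]; ring
  simp only [h3, h2, h1, hI, Complex.I_sq, pow_one, Fin.val_zero, pow_zero]
  conv_rhs => rw [← Complex.re_add_im (c k), ← hmax (c k).re, ← hmax (c k).im]
  simp
  ring

theorem exists_atoms_approx {ι G : Type*} [Fintype ι] [Fintype G] {e : ι → G → ℂ}
    (he : ∀ k x, ‖e k x‖ ≤ 1) {c : ι → ℂ} {T η : ℝ} (hT : 0 < T) (hη : 0 < η)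
    (hc : ∑ k, ‖c k‖ ≤ T) {M : ℕ} (hM0 : 0 < M)
    (hM : 8 * Real.log (4 * Fintype.card G) ≤ M * η ^ 2) :
    ∃ t : Fin M → Option (ι × Fin 4), ∀ x,
      ‖∑ k, c k * e k x - (2 * T / M : ℝ) * ∑ j, atom e (t j) x‖ ≤ 4 * T * η := by
  -- The extra label runs over the rotations `i ^ r`, so a one-sided estimate controls ±Re and ±Im.
  -- With parameter η/4, the logarithmic term and the Hoeffding term are each at most Mη²/8.
  obtain ⟨t, ht⟩ := exists_empirical_le (Y := G × Fin 4) (atomWeight c T)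
    (atomWeight_nonneg hT hc) (sum_atomWeight c T)
    (fun a y => (Complex.I ^ (y.2 : ℕ) * atom e a y.1).re) (fun a y => by
      refine (Complex.abs_re_le_norm _).trans ?_
      simpa using norm_atom_le he a y.1) (η / 4) M
  refine ⟨t, fun x => ?_⟩
  have hMR : (0 : ℝ) < M := by exact_mod_cast hM0
  set D : ℂ := ∑ j, atom e (t j) x - M * ((∑ k, c k * e k x) / (2 * T)) with hD
  have hbound : ∀ r : Fin 4, (Complex.I ^ (r : ℕ) * D).re ≤ M * η := fun r => by
    have hS : (Complex.I ^ (r : ℕ) * D).re =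
        ∑ j, ((Complex.I ^ (r : ℕ) * atom e (t j) x).re -
          ∑ a, atomWeight c T a * (Complex.I ^ (r : ℕ) * atom e a x).re) := by
      rw [hD, ← sum_atomWeight_mul_atom, sum_sub_distrib, mul_sub, Complex.sub_re, mul_sum,
        Complex.re_sum]
      congr 1
      rw [sum_const, card_univ, Fintype.card_fin, nsmul_eq_mul,
        show Complex.I ^ (r : ℕ) * (M * ∑ a, (atomWeight c T a : ℂ) * atom e a x) =
          (M : ℝ) * ∑ a, (atomWeight c T a : ℂ) * (Complex.I ^ (r : ℕ) * atom e a x) by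
            rw [mul_sum, mul_sum, mul_sum]
            exact sum_congr rfl fun _ _ => by push_cast; ring,
        Complex.re_ofReal_mul, Complex.re_sum]
      simp only [Complex.re_ofReal_mul]
    have h1 := (single_le_sum (f := fun y : G × Fin 4 => Real.exp (η / 4 *
        ∑ j, ((Complex.I ^ (y.2 : ℕ) * atom e (t j) y.1).re -
          ∑ a, atomWeight c T a * (Complex.I ^ (y.2 : ℕ) * atom e a y.1).re)))
        (fun y _ => (Real.exp_pos _).le) (mem_univ (x, r))).trans ht
    simp only at h1
    rw [← hS] at h1
    have hG : (0 : ℝ) < Fintype.card (G × Fin 4) := by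
      have : Nonempty (G × Fin 4) := ⟨(x, r)⟩
      exact_mod_cast Fintype.card_pos
    have h2 := Real.log_le_log (Real.exp_pos _) h1
    rw [Real.log_exp, Real.log_mul hG.ne' (Real.exp_pos _).ne', Real.log_exp,
      Fintype.card_prod, Fintype.card_fin] at h2
    push_cast at h2
    rw [mul_comm (Fintype.card G : ℝ) 4] at h2
    have h3 : η * (Complex.I ^ (r : ℕ) * D).re ≤ η * (M * η) := by nlinarith
    exact le_of_mul_le_mul_left h3 hη
  have hre : |D.re| ≤ M * η := abs_le.2 ⟨by
    have := hbound 2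
    simp [Complex.I_sq] at this; linarith, by
    have := hbound 0
    simpa using this⟩
  have him : |D.im| ≤ M * η := abs_le.2 ⟨by
    have := hbound 1
    simp at this; linarith, by
    have := hbound 3
    rw [show ((3 : Fin 4) : ℕ) = 3 from rfl,
      show Complex.I ^ 3 = -Complex.I by rw [pow_succ, Complex.I_sq]; ring] at this
    simpa using this⟩
  have hT' : (T : ℂ) ≠ 0 := by exact_mod_cast hT.ne'
  have hM' : (M : ℂ) ≠ 0 := by exact_mod_cast hMR.ne'
  have heq : ∑ k, c k * e k x - (2 * T / M : ℝ) * ∑ j, atom e (t j) x =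
      -((2 * T / M : ℝ) * D) := by
    rw [hD]; push_cast; field_simp; ring
  rw [heq, norm_neg, norm_mul, Complex.norm_real, Real.norm_of_nonneg (by positivity)]
  calc 2 * T / M * ‖D‖ ≤ 2 * T / M * (2 * (M * η)) := by
        refine mul_le_mul_of_nonneg_left ?_ (by positivity)
        linarith [Complex.norm_le_abs_re_add_abs_im D]
    _ = 4 * T * η := by field_simp; ring

/-! ### Norming points for functions with small coefficient sums -/

/-- `P` must not depend on `c`, so it is chosen to hit the large level sets of all averages of `M`
atoms. At height 2^i these sets have density of order 4^(-i)/(L+1), but accuracy 2^i/8 needs only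
`M` of order 4^(L-i) atoms; hence the same number of points serves at every level. -/
theorem exists_level_points {ι G : Type*} [Fintype ι] [Fintype G] [Nonempty G]
    {e : ι → G → ℂ} (he : ∀ k x, ‖e k x‖ ≤ 1) {L A B : ℕ}
    (hA : 8192 * Real.log (4 * Fintype.card G) ≤ A)
    (hB : 2 * Real.log (4 * Fintype.card ι + 1) < B) {i : ℕ} (hi : i ≤ L) :
    ∃ P : Finset G, #P ≤ (L + 1) * 4 ^ L * A * B ∧ ∀ c : ι → ℂ, ∑ k, ‖c k‖ ≤ 2 ^ L →
      3 / (4 * (L + 1) * 4 ^ i) * Fintype.card G ≤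
        (#{x : G | (2 : ℝ) ^ i / 2 ≤ ‖∑ k, c k * e k x‖} : ℝ) →
      ∃ x ∈ P, 1 / 4 ≤ ‖∑ k, c k * e k x‖ := by
  classical
  have hA0 : 0 < A := by
    have h1 : (1 : ℝ) ≤ Fintype.card G := by exact_mod_cast Fintype.card_pos
    have : 0 < Real.log (4 * Fintype.card G) := Real.log_pos (by linarith)
    have : (0 : ℝ) < A := by linarith
    exact_mod_cast this
  set M := A * 4 ^ (L - i) with hM
  have hM0 : 0 < M := by positivity
  set p : ℝ := 3 / (4 * (L + 1) * 4 ^ i) with hp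
  have hp1 : p ≤ 1 := by
    rw [hp, div_le_one (by positivity)]
    have h1 : (1 : ℝ) ≤ 4 ^ i := one_le_pow₀ (by norm_num)
    have h2 : (0 : ℝ) ≤ L := by positivity
    nlinarith
  set S : (Fin M → Option (ι × Fin 4)) → Finset G := fun t =>
    {x | 3 / 4 * ((2 : ℝ) ^ i / 2) ≤ ‖((2 * 2 ^ L / M : ℝ) : ℂ) * ∑ j, atom e (t j) x‖} with hS
  obtain ⟨P, hP, hPF⟩ := exists_hitting_finset
    (F := {t | p * Fintype.card G ≤ #(S t)}) S hp1 (fun t ht => (mem_filter.1 ht).2)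
    ((L + 1) * 4 ^ L * A * B)
  refine ⟨P, hP, fun c hc hlarge => ?_⟩
  have h4 : (4 : ℝ) ^ (L - i) * 4 ^ i = 4 ^ L := by rw [← pow_add, Nat.sub_add_cancel hi]
  obtain ⟨t, ht⟩ := exists_atoms_approx he (T := 2 ^ L) (η := 2 ^ i / (32 * 2 ^ L))
    (by positivity) (by positivity) hc hM0 (by
      have : ((M : ℕ) : ℝ) * (2 ^ i / (32 * 2 ^ L)) ^ 2 = A / 1024 := by
        have e1 : ((2 : ℝ) ^ i) ^ 2 = 4 ^ i := by rw [← pow_mul, mul_comm, pow_mul]; norm_num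
        have e2 : ((2 : ℝ) ^ L) ^ 2 = 4 ^ L := by rw [← pow_mul, mul_comm, pow_mul]; norm_num
        rw [hM, div_pow, mul_pow, e1, e2, ← h4]
        push_cast
        field_simp
        norm_num
      rw [this]; linarith)
  have hη : 4 * (2 : ℝ) ^ L * (2 ^ i / (32 * 2 ^ L)) = 2 ^ i / 2 / 4 := by field_simp; norm_num
  simp only [hη] at ht
  have htF : t ∈ ({t | p * Fintype.card G ≤ #(S t)} : Finset _) := by
    refine mem_filter.2 ⟨mem_univ _, hlarge.trans ?_⟩
    exact Nat.cast_le.2 <| card_le_card fun x hx => by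
      simp only [hS, mem_filter, mem_univ, true_and] at hx ⊢
      have := norm_sub_norm_le (∑ k, c k * e k x)
        (((2 * 2 ^ L / M : ℝ) : ℂ) * ∑ j, atom e (t j) x)
      linarith [ht x]
  -- There are at most (4|ι|+1)^M tuples, while `p` times the number of points is 3MB/4. The choice
  -- of `B` leaves fewer than one tuple unhit.
  have hlt : (1 - p) ^ ((L + 1) * 4 ^ L * A * B) *
      (#({t | p * Fintype.card G ≤ #(S t)} : Finset (Fin M → Option (ι × Fin 4))) : ℝ) < 1 := by
    have hcard : (#({t | p * Fintype.card G ≤ #(S t)} :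
        Finset (Fin M → Option (ι × Fin 4))) : ℝ) ≤ (4 * Fintype.card ι + 1 : ℝ) ^ M := by
      have h0 := card_filter_le (univ : Finset (Fin M → Option (ι × Fin 4)))
        (fun t => p * Fintype.card G ≤ #(S t))
      rw [card_univ, Fintype.card_fun, Fintype.card_option, Fintype.card_prod,
        Fintype.card_fin, Fintype.card_fin, mul_comm (Fintype.card ι)] at h0
      exact_mod_cast h0
    have hpos : (0 : ℝ) < 4 * Fintype.card ι + 1 := by positivity
    calc _ ≤ Real.exp (-p) ^ ((L + 1) * 4 ^ L * A * B) * (4 * Fintype.card ι + 1 : ℝ) ^ M := by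
          refine mul_le_mul (pow_le_pow_left₀ (by linarith) ?_ _) hcard (by positivity)
            (by positivity)
          linarith [Real.add_one_le_exp (-p)]
      _ = Real.exp (M * (Real.log (4 * Fintype.card ι + 1) - 3 / 4 * B)) := by
          rw [← Real.exp_nat_mul, ← Real.exp_log hpos, ← Real.exp_nat_mul, ← Real.exp_add,
            Real.log_exp]
          congr 1
          rw [hM, hp]
          push_cast
          rw [← h4]
          have : (L : ℝ) + 1 ≠ 0 := by positivity
          field_simp
          ring
      _ < 1 := by
          rw [Real.exp_lt_one_iff]
          refine mul_neg_of_pos_of_neg (by exact_mod_cast hM0) ?_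
          have : (0:ℝ) ≤ B := by positivity
          linarith
  have hempty := Nat.lt_one_iff.1 (by exact_mod_cast hPF.trans_lt hlt)
  have hnd : ¬ Disjoint (S t) P := fun hd => by
    have := card_eq_zero.1 hempty
    exact notMem_empty t (this ▸ mem_filter.2 ⟨htF, hd⟩)
  obtain ⟨x, hxS, hxP⟩ := not_disjoint_iff.1 hnd
  refine ⟨x, hxP, ?_⟩
  simp only [hS, mem_filter, mem_univ, true_and] at hxS
  have h1 := norm_sub_norm_le (((2 * 2 ^ L / M : ℝ) : ℂ) * ∑ j, atom e (t j) x)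
    (∑ k, c k * e k x)
  rw [norm_sub_rev] at h1
  have h2 : (1 : ℝ) ≤ 2 ^ i := one_le_pow₀ (by norm_num)
  linarith [ht x]

/-- A finite set of points at which no normalized function `∑ c_k e_k` with small `∑ |c_k|` can
be uniformly small. -/
theorem exists_norming_points {ι G : Type*} [Fintype ι] [Fintype G] [Nonempty G]
    {e : ι → G → ℂ} (he : ∀ k x, ‖e k x‖ ≤ 1)
    (horth : ∀ c : ι → ℂ, ∑ x, ‖∑ k, c k * e k x‖ ^ 2 = Fintype.card G * ∑ k, ‖c k‖ ^ 2)
    {L A B : ℕ} (hA : 8192 * Real.log (4 * Fintype.card G) ≤ A)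
    (hB : 2 * Real.log (4 * Fintype.card ι + 1) < B) :
    ∃ P : Finset G, #P ≤ (L + 1) * ((L + 1) * 4 ^ L * A * B) ∧
      ∀ c : ι → ℂ, ∑ k, ‖c k‖ ≤ 2 ^ L → ∑ k, ‖c k‖ ^ 2 = 1 →
      ∃ x ∈ P, 1 / 4 ≤ ‖∑ k, c k * e k x‖ := by
  classical
  have hlev : ∀ i : ℕ, ∃ P : Finset G, i ≤ L → #P ≤ (L + 1) * 4 ^ L * A * B ∧
      ∀ c : ι → ℂ, ∑ k, ‖c k‖ ≤ 2 ^ L →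
      3 / (4 * (L + 1) * 4 ^ i) * Fintype.card G ≤
        (#{x : G | (2 : ℝ) ^ i / 2 ≤ ‖∑ k, c k * e k x‖} : ℝ) →
      ∃ x ∈ P, 1 / 4 ≤ ‖∑ k, c k * e k x‖ := fun i => by
    by_cases hi : i ≤ L
    · obtain ⟨P, hP⟩ := exists_level_points he hA hB hi
      exact ⟨P, fun _ => hP⟩
    · exact ⟨∅, fun h => absurd h hi⟩
  choose P hP using hlev
  refine ⟨(range (L + 1)).biUnion P, ?_, fun c hc hc2 => ?_⟩
  · refine card_biUnion_le.trans ((sum_le_card_nsmul _ _ _ fun i hi =>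
      (hP i (Nat.lt_succ_iff.1 (mem_range.1 hi))).1).trans ?_)
    simp
  set h : G → ℂ := fun x => ∑ k, c k * e k x with hh
  have hbd : ∀ x, ‖h x‖ ≤ 2 ^ L := fun x => by
    refine (norm_sum_le _ _).trans (le_trans (sum_le_sum fun k _ => ?_) hc)
    rw [norm_mul]
    exact mul_le_of_le_one_right (norm_nonneg _) (he k x)
  -- Dyadic layer-cake bound; the values below 1/2 account for the 1/4. As the mean of |h|² is 1,
  -- the levels carry at least 3/4, and one of the L+1 levels carries its share.
  have hpt : ∀ x, ‖h x‖ ^ 2 ≤ 1 / 4 +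
      ∑ i ∈ range (L + 1), if (2 : ℝ) ^ i / 2 ≤ ‖h x‖ then (4 : ℝ) ^ i else 0 := fun x => by
    have hnn : ∀ i ∈ range (L + 1),
        (0 : ℝ) ≤ if (2 : ℝ) ^ i / 2 ≤ ‖h x‖ then (4 : ℝ) ^ i else 0 := fun i _ => by
      split_ifs <;> positivity
    by_cases hs : ‖h x‖ < 1 / 2
    · have := sum_nonneg hnn
      nlinarith [norm_nonneg (h x)]
    · set i := Nat.findGreatest (fun i => (2 : ℝ) ^ i / 2 ≤ ‖h x‖) L with hi
      have hiL : i ≤ L := Nat.findGreatest_le L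
      have hisp : (2 : ℝ) ^ i / 2 ≤ ‖h x‖ :=
        Nat.findGreatest_spec (P := fun i => (2 : ℝ) ^ i / 2 ≤ ‖h x‖) (Nat.zero_le L)
          (by simpa using hs)
      have hup : ‖h x‖ ≤ 2 ^ i := by
        rcases hiL.eq_or_lt with h1 | h1
        · rw [h1]; exact hbd x
        · have := Nat.findGreatest_is_greatest (Nat.lt_succ_self i) h1
          rw [not_le, pow_succ] at this
          linarith
      have h1 := single_le_sum hnn (mem_range.2 (Nat.lt_succ_iff.2 hiL))
      rw [if_pos hisp] at h1
      have h2 : ‖h x‖ ^ 2 ≤ (2 ^ i) ^ 2 := pow_le_pow_left₀ (norm_nonneg _) hup 2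
      rw [← pow_mul, mul_comm, pow_mul] at h2
      norm_num at h2
      linarith
  have hG : (0 : ℝ) < Fintype.card G := by exact_mod_cast Fintype.card_pos
  have htot : (Fintype.card G : ℝ) ≤ Fintype.card G * (1 / 4) +
      ∑ i ∈ range (L + 1), (4 : ℝ) ^ i * #{x : G | (2 : ℝ) ^ i / 2 ≤ ‖h x‖} := by
    calc (Fintype.card G : ℝ) = ∑ x, ‖h x‖ ^ 2 := by rw [hh, horth, hc2, mul_one]
      _ ≤ _ := sum_le_sum fun x _ => hpt x
      _ = _ := by
        rw [sum_add_distrib, sum_comm]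
        simp [← sum_filter, mul_comm]
  have hlow : ∑ _i ∈ range (L + 1), (3 / 4 * (Fintype.card G : ℝ) / (L + 1)) ≤
      ∑ i ∈ range (L + 1), (4 : ℝ) ^ i * #{x : G | (2 : ℝ) ^ i / 2 ≤ ‖h x‖} := by
    rw [sum_const, card_range, nsmul_eq_mul]
    push_cast
    rw [mul_div_cancel₀ _ (by positivity)]
    linarith
  obtain ⟨i, hi, hle⟩ := exists_le_of_sum_le (nonempty_range_iff.2 (Nat.succ_ne_zero L)) hlow
  obtain ⟨x, hx, hx'⟩ := (hP i (Nat.lt_succ_iff.1 (mem_range.1 hi))).2 c hc (by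
    rw [div_mul_eq_mul_div, div_le_iff₀ (by positivity)]
    rw [div_le_iff₀ (by positivity)] at hle
    linarith)
  exact ⟨x, mem_biUnion.2 ⟨i, hi, hx⟩, hx'⟩

/-! ### The trigonometric system on the torus -/

theorem trigSystem_eq_prod (d : ℕ) (k : Fin d → ℤ) (x : Fin d → ℝ) :
    trigSystem d k x = ∏ j, Complex.exp (Complex.I * ((k j : ℂ) * (x j : ℂ))) := by
  rw [trigSystem, mul_sum, Complex.exp_sum]

theorem norm_trigSystem (d : ℕ) (k : Fin d → ℤ) (x : Fin d → ℝ) : ‖trigSystem d k x‖ = 1 := by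
  have : Complex.I * ∑ j, (k j : ℂ) * (x j : ℂ) = ((∑ j, (k j : ℝ) * x j : ℝ) : ℂ) * Complex.I := by
    push_cast; ring
  rw [trigSystem, this, Complex.norm_exp_ofReal_mul_I]

theorem trigSystem_mul_conj (d : ℕ) (k l : Fin d → ℤ) (x : Fin d → ℝ) :
    trigSystem d k x * (starRingEnd ℂ) (trigSystem d l x) = trigSystem d (k - l) x := by
  rw [trigSystem, trigSystem, trigSystem, ← Complex.exp_conj, ← Complex.exp_add]
  congr 1
  simp only [map_mul, map_sum, Complex.conj_I, Complex.conj_ofReal, map_intCast, Pi.sub_apply]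
  push_cast
  simp only [sub_mul, sum_sub_distrib]
  ring

theorem continuous_trigSystem (d : ℕ) (k : Fin d → ℤ) : Continuous (trigSystem d k) := by
  unfold trigSystem
  fun_prop

theorem norm_sum_trigSystem_sq {d : ℕ} (S : Finset (Fin d → ℤ)) (c : (Fin d → ℤ) → ℂ)
    (x : Fin d → ℝ) :
    ((‖∑ k ∈ S, c k * trigSystem d k x‖ ^ 2 : ℝ) : ℂ) =
      ∑ k ∈ S, ∑ l ∈ S, c k * (starRingEnd ℂ) (c l) * trigSystem d (k - l) x := by
  rw [← Complex.normSq_eq_norm_sq, ← Complex.mul_conj, map_sum, sum_mul_sum]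
  refine sum_congr rfl fun k _ => sum_congr rfl fun l _ => ?_
  rw [map_mul, ← trigSystem_mul_conj]
  ring

theorem integral_exp_two_pi (n : ℤ) :
    ∫ t in Set.Icc 0 (2 * Real.pi), Complex.exp (Complex.I * ((n : ℂ) * (t : ℂ))) =
      if n = 0 then ((2 * Real.pi : ℝ) : ℂ) else 0 := by
  rw [integral_Icc_eq_integral_Ioc, ← intervalIntegral.integral_of_le (by positivity)]
  split_ifs with h
  · simp [h]
  · have hn : Complex.I * (n : ℂ) ≠ 0 := mul_ne_zero Complex.I_ne_zero (by exact_mod_cast h)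
    simp only [← mul_assoc]
    rw [integral_exp_mul_complex hn]
    have : Complex.exp (Complex.I * n * ((2 * Real.pi : ℝ) : ℂ)) = 1 :=
      Complex.exp_eq_one_iff.2 ⟨n, by push_cast; ring⟩
    rw [this]
    simp

theorem volume_restrict_torus (d : ℕ) :
    (volume : Measure (Fin d → ℝ)).restrict (torus d) =
      Measure.pi fun _ => (volume : Measure ℝ).restrict (Set.Icc 0 (2 * Real.pi)) := by
  rw [torus, ← Set.pi_univ_Icc, volume_pi, Measure.restrict_pi_pi]
  rfl

theorem integral_trigSystem (d : ℕ) (k : Fin d → ℤ) :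
    ∫ x, trigSystem d k x ∂torusMeasure d = if k = 0 then 1 else 0 := by
  have h2 : (0 : ℝ) < 2 * Real.pi := by positivity
  rw [torusMeasure, integral_smul_measure, volume_restrict_torus]
  simp only [trigSystem_eq_prod]
  rw [integral_fintype_prod_eq_prod (𝕜 := ℂ)
    (fun (j : Fin d) (t : ℝ) => Complex.exp (Complex.I * ((k j : ℂ) * (t : ℂ))))]
  simp only [integral_exp_two_pi]
  rw [ENNReal.toReal_ofReal (by positivity)]
  split_ifs with h
  · have h2' : ((2 * Real.pi : ℝ) : ℂ) ≠ 0 := by exact_mod_cast h2.ne'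
    subst h
    simp only [Pi.zero_apply, if_true, prod_const, card_univ, Fintype.card_fin]
    rw [Complex.real_smul]
    push_cast at h2' ⊢
    field_simp
  · obtain ⟨j, hj⟩ := Function.ne_iff.1 h
    rw [prod_eq_zero (mem_univ j) (if_neg hj), smul_zero]

instance isProbabilityMeasure_torusMeasure (d : ℕ) : IsProbabilityMeasure (torusMeasure d) := by
  have h2 : (0 : ℝ) < 2 * Real.pi := by positivity
  refine ⟨?_⟩
  rw [torusMeasure, volume_restrict_torus, Measure.smul_apply, Measure.pi_univ]
  simp only [Measure.restrict_apply_univ, Real.volume_Icc, sub_zero, prod_const, card_univ,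
    Fintype.card_fin, smul_eq_mul]
  rw [← ENNReal.ofReal_pow h2.le, ← ENNReal.ofReal_mul (by positivity),
    inv_mul_cancel₀ (by positivity), ENNReal.ofReal_one]

theorem integrable_of_continuous {d : ℕ} {E : Type*} [NormedAddCommGroup E]
    {f : (Fin d → ℝ) → E} (hf : Continuous f) : Integrable f (torusMeasure d) :=
  ((hf.continuousOn.integrableOn_compact isCompact_Icc).smul_measure ENNReal.ofReal_ne_top)

theorem integrable_const_mul_trigSystem {d : ℕ} (z : ℂ) (k : Fin d → ℤ) :
    Integrable (fun x => z * trigSystem d k x) (torusMeasure d) :=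
  (integrable_of_continuous (continuous_trigSystem d k)).const_mul z

theorem integral_sum_trigSystem {d : ℕ} (S : Finset (Fin d → ℤ)) (c : (Fin d → ℤ) → ℂ)
    (hc : 0 ∉ S → c 0 = 0) :
    ∫ x, ∑ k ∈ S, c k * trigSystem d k x ∂torusMeasure d = c 0 := by
  rw [integral_finsetSum _ fun k _ =>
    integrable_const_mul_trigSystem _ _]
  simp only [integral_const_mul, integral_trigSystem, mul_ite, mul_one, mul_zero, sum_ite_eq']
  split_ifs with h
  · rfl
  · exact (hc h).symm

theorem integral_norm_sum_trigSystem_sq {d : ℕ} (S : Finset (Fin d → ℤ))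
    (c : (Fin d → ℤ) → ℂ) :
    ∫ x, ‖∑ k ∈ S, c k * trigSystem d k x‖ ^ 2 ∂torusMeasure d = ∑ k ∈ S, ‖c k‖ ^ 2 := by
  have h : ((∫ x, ‖∑ k ∈ S, c k * trigSystem d k x‖ ^ 2 ∂torusMeasure d : ℝ) : ℂ) =
      ((∑ k ∈ S, ‖c k‖ ^ 2 : ℝ) : ℂ) := by
    rw [← integral_complex_ofReal]
    simp only [norm_sum_trigSystem_sq]
    rw [integral_finsetSum _ fun k _ => integrable_finsetSum _ fun l _ =>
      integrable_const_mul_trigSystem _ _]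
    push_cast
    refine sum_congr rfl fun k hk => ?_
    rw [integral_finsetSum _ fun l _ =>
      integrable_const_mul_trigSystem _ _]
    simp only [integral_const_mul, integral_trigSystem, sub_eq_zero, mul_ite, mul_one, mul_zero,
      sum_ite_eq, hk, if_true]
    rw [Complex.mul_conj, Complex.normSq_eq_norm_sq]
    norm_cast
  exact_mod_cast h

/-! ### Discrete orthogonality on a uniform grid -/

/-- The points of the uniform grid with `D` points in each direction. -/
noncomputable def gridPoint {d : ℕ} (D : ℕ) (g : Fin d → Fin D) (j : Fin d) : ℝ :=
  2 * Real.pi * (g j : ℕ) / D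

theorem gridPoint_mem_torus {d : ℕ} (D : ℕ) (g : Fin d → Fin D) : gridPoint D g ∈ torus d := by
  refine ⟨fun j => ?_, fun j => ?_⟩
  · simp only [gridPoint, Pi.zero_apply]; positivity
  · have hD : 0 < D := (Nat.zero_le _).trans_lt (g j).2
    have hDR : (0 : ℝ) < D := by exact_mod_cast hD
    have : ((g j : ℕ) : ℝ) ≤ D := by exact_mod_cast (g j).2.le
    simp only [gridPoint]
    rw [div_le_iff₀ hDR]
    exact mul_le_mul_of_nonneg_left this (by positivity)

theorem sum_exp_grid {D : ℕ} {n : ℤ} (hn : |n| < D) :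
    ∑ g : Fin D, Complex.exp (Complex.I * ((n : ℂ) * ((2 * Real.pi * (g : ℕ) / D : ℝ) : ℂ))) =
      if n = 0 then (D : ℂ) else 0 := by
  split_ifs with h
  · simp [h]
  · have hD : (D : ℂ) ≠ 0 := by
      have : 0 < D := by have := abs_nonneg n; omega
      exact_mod_cast this.ne'
    set z := Complex.exp (2 * Real.pi * Complex.I * n / D) with hz
    have hpow : ∀ g : Fin D,
        Complex.exp (Complex.I * ((n : ℂ) * ((2 * Real.pi * (g : ℕ) / D : ℝ) : ℂ))) =
          z ^ (g : ℕ) := fun g => by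
      rw [hz, ← Complex.exp_nat_mul]; congr 1; push_cast; ring
    simp only [hpow]
    rw [Fin.sum_univ_eq_sum_range (fun g => z ^ g) D]
    have h1 : z ^ D = 1 := by
      rw [hz, ← Complex.exp_nat_mul]
      exact Complex.exp_eq_one_iff.2 ⟨n, by field_simp⟩
    have h2 : z ≠ 1 := fun hz1 => by
      obtain ⟨q, hq⟩ := Complex.exp_eq_one_iff.1 hz1
      have hp : (2 * Real.pi * Complex.I : ℂ) ≠ 0 := Complex.two_pi_I_ne_zero
      have : (n : ℂ) = q * D := by
        field_simp at hq
        linear_combination hq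
      have hq' : n = q * D := by exact_mod_cast this
      exact h (Int.eq_zero_of_abs_lt_dvd (Dvd.intro_left q hq'.symm) hn)
    have h3 := mul_geom_sum z D
    rw [h1, sub_self] at h3
    exact (mul_eq_zero.1 h3).resolve_left (sub_ne_zero.2 h2)

theorem sum_trigSystem_grid {d D : ℕ} {k : Fin d → ℤ} (hk : ∀ j, |k j| < D) :
    ∑ g : Fin d → Fin D, trigSystem d k (gridPoint D g) = if k = 0 then (D : ℂ) ^ d else 0 := by
  simp only [trigSystem_eq_prod, gridPoint]
  rw [← Fintype.prod_sum (fun (j : Fin d) (g : Fin D) =>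
    Complex.exp (Complex.I * ((k j : ℂ) * ((2 * Real.pi * (g : ℕ) / D : ℝ) : ℂ))))]
  simp only [sum_exp_grid (hk _)]
  split_ifs with h
  · simp [h]
  · obtain ⟨j, hj⟩ := Function.ne_iff.1 h
    exact prod_eq_zero (mem_univ j) (if_neg hj)

/-- The cube of frequencies `|k_j| < D`. -/
noncomputable def freqCube (d D : ℕ) : Finset (Fin d → ℤ) :=
  Fintype.piFinset fun _ => Finset.Ioo (-(D : ℤ)) D

theorem mem_freqCube {d D : ℕ} {k : Fin d → ℤ} : k ∈ freqCube d D ↔ ∀ j, |k j| < D := by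
  simp [freqCube, abs_lt]

/-- Differences of two frequencies in the cube are below 2D in modulus, so 2D points per direction
suffice for exact orthogonality. -/
theorem sum_grid_norm_sq {d D : ℕ} (c : (Fin d → ℤ) → ℂ) :
    ∑ g : Fin d → Fin (2 * D), ‖∑ k ∈ freqCube d D, c k * trigSystem d k (gridPoint (2 * D) g)‖ ^ 2
      = (2 * D : ℝ) ^ d * ∑ k ∈ freqCube d D, ‖c k‖ ^ 2 := by
  have h : ((∑ g : Fin d → Fin (2 * D),
      ‖∑ k ∈ freqCube d D, c k * trigSystem d k (gridPoint (2 * D) g)‖ ^ 2 : ℝ) : ℂ) =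
      (((2 * D : ℝ) ^ d * ∑ k ∈ freqCube d D, ‖c k‖ ^ 2 : ℝ) : ℂ) := by
    rw [Complex.ofReal_sum]
    simp only [norm_sum_trigSystem_sq]
    rw [sum_comm]
    push_cast
    rw [mul_sum]
    refine sum_congr rfl fun k hk => ?_
    rw [sum_comm]
    have : ∀ l ∈ freqCube d D, ∑ g : Fin d → Fin (2 * D),
        c k * (starRingEnd ℂ) (c l) * trigSystem d (k - l) (gridPoint (2 * D) g) =
        if k = l then c k * (starRingEnd ℂ) (c l) * ((2 * D : ℕ) : ℂ) ^ d else 0 := fun l hl => by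
      rw [← mul_sum, sum_trigSystem_grid, mul_ite, mul_zero]
      · simp only [sub_eq_zero]
      · intro j
        have h1 := mem_freqCube.1 hk j
        have h2 := mem_freqCube.1 hl j
        have := abs_sub (k j) (l j)
        rw [Pi.sub_apply]
        push_cast
        linarith
    rw [sum_congr rfl this, sum_ite_eq, if_pos hk, Complex.mul_conj, Complex.normSq_eq_norm_sq]
    push_cast
    ring
  exact_mod_cast h

/-! ### Dyadic blocks and fooling polynomials -/

/-- The index of the dyadic block that contains `k`. -/
def blockIndex {d : ℕ} (k : Fin d → ℤ) (j : Fin d) : ℕ := Nat.size (k j).natAbs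

theorem abs_lt_two_pow_iff {n : ℤ} {s : ℕ} : |n| < 2 ^ s ↔ n.natAbs.size ≤ s := by
  rw [Nat.size_le, Int.abs_eq_natAbs]
  norm_cast

/-- Both conditions say that |n| has exactly `s` binary digits, zero having none; hence the blocks
partition ℤ^d. -/
theorem dyadic_iff {n : ℤ} {s : ℕ} :
    (|n| < 2 ^ s ∧ ⌊(2 : ℝ) ^ ((s : ℤ) - 1)⌋ ≤ |n|) ↔ n.natAbs.size = s := by
  rw [abs_lt_two_pow_iff]
  rcases s with _ | t
  · have : ⌊(2 : ℝ) ^ (((0 : ℕ) : ℤ) - 1)⌋ = 0 := by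
      rw [Int.floor_eq_zero_iff]; norm_num
    rw [this]
    simp
  · have : ⌊(2 : ℝ) ^ (((t + 1 : ℕ) : ℤ) - 1)⌋ = 2 ^ t := by
      rw [show ((t + 1 : ℕ) : ℤ) - 1 = (t : ℤ) by push_cast; ring, zpow_natCast]
      exact_mod_cast Int.floor_intCast (R := ℝ) (2 ^ t)
    rw [this, ← not_lt (a := |n|), abs_lt_two_pow_iff]
    omega

theorem mem_dyadicBlock {d : ℕ} {s : Fin d → ℕ} {k : Fin d → ℤ} :
    k ∈ dyadicBlock s ↔ blockIndex k = s := by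
  simp only [dyadicBlock, Fintype.mem_piFinset, Finset.mem_filter, Finset.mem_Ioo, ← abs_lt,
    dyadic_iff, funext_iff, blockIndex]

theorem card_dyadicBlock_le {d : ℕ} (s : Fin d → ℕ) : #(dyadicBlock s) ≤ 2 ^ (∑ j, s j + d) := by
  rw [dyadicBlock, Fintype.card_piFinset]
  calc _ ≤ ∏ j : Fin d, 2 ^ (s j + 1) := prod_le_prod' fun j _ => by
        refine (card_filter_le _ _).trans ?_
        rw [Int.card_Ioo, pow_succ]
        have : ((2 ^ s j : ℕ) : ℤ) = 2 ^ s j := by push_cast; rfl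
        omega
    _ = _ := by rw [prod_pow_eq_pow_sum, sum_add_distrib]; simp

/-- A trigonometric polynomial that vanishes at given points, with large mean and small norm. -/
theorem exists_fooling_coeffs {d m D : ℕ} (s : Fin d → ℕ) (hD : ∀ j, 2 ^ s j ≤ D)
    (hm : 2 * m ≤ 2 ^ ∑ j, s j) (ξ : Fin m → Fin d → ℝ) :
    ∃ c : (Fin d → ℤ) → ℂ, (∀ q, ¬ (blockIndex q ≤ s) → c q = 0) ∧
      (∀ i, ∑ q ∈ freqCube d D, c q * trigSystem d q (ξ i) = 0) ∧
      ∑ q ∈ freqCube d D, ‖c q‖ ^ 2 ≤ 1 ∧ 1 / 2 ≤ (c 0).re := by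
  classical
  set Λ : Finset (Fin d → ℤ) := Fintype.piFinset fun j => Finset.Ico 0 (2 ^ s j) with hΛ
  have hcardΛ : Fintype.card Λ = 2 ^ ∑ j, s j := by
    rw [Fintype.card_coe, hΛ, Fintype.card_piFinset, ← prod_pow_eq_pow_sum]
    refine prod_congr rfl fun j _ => ?_
    rw [Int.card_Ico, sub_zero]
    exact_mod_cast Int.toNat_natCast (2 ^ s j)
  set N : ℝ := 2 ^ ∑ j, s j with hN
  have hN0 : 0 < N := by positivity
  let E := EuclideanSpace ℂ Λ
  -- The conjugate makes the inner product with `w x` the evaluation at `x` of the polynomial with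
  -- coefficients `v`.
  let w : (Fin d → ℝ) → E := fun x => WithLp.toLp 2 fun k => (starRingEnd ℂ) (trigSystem d k.1 x)
  have hwn : ∀ x, ‖w x‖ ^ 2 = N := fun x => by
    rw [EuclideanSpace.norm_sq_eq]
    simp only [w, RCLike.norm_conj, norm_trigSystem, one_pow, sum_const, card_univ, hcardΛ]
    simp [hN]
  have hwi : ∀ x (v : E), inner ℂ (w x) v = ∑ k, v k * trigSystem d k.1 x := fun x v => by
    rw [PiLp.inner_apply]
    refine sum_congr rfl fun k _ => ?_
    simp [w]
  let ev : E →ₗ[ℂ] (Fin m → ℂ) := LinearMap.pi fun i => innerₛₗ ℂ (w (ξ i))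
  let V := LinearMap.ker ev
  have hfin : (2 : ℝ) * Module.finrank ℂ V ≥ N := by
    have h1 := LinearMap.finrank_range_add_finrank_ker ev
    have h2 : Module.finrank ℂ (LinearMap.range ev) ≤ m := by
      simpa using Submodule.finrank_le (LinearMap.range ev)
    have h3 : Module.finrank ℂ E = 2 ^ ∑ j, s j := by
      rw [finrank_euclideanSpace, hcardΛ]
    have h4 : 2 ^ (∑ j, s j) ≤ 2 * Module.finrank ℂ V := by
      change _ + Module.finrank ℂ V = _ at h1
      omega
    rw [hN, ge_iff_le]
    exact_mod_cast h4
  let b := stdOrthonormalBasis ℂ V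
  have hb : Orthonormal ℂ fun r => (b r : E) := b.orthonormal.comp_linearIsometry V.subtypeₗᵢ
  have hbξ : ∀ r i, inner ℂ (w (ξ i)) (b r : E) = 0 := fun r i => by
    have := LinearMap.mem_ker.1 (b r).2
    exact congrFun this i
  -- The diagonal of the reproducing kernel of `V`, divided by `N`. Bessel's inequality gives f ≤ 1,
  -- and the mean is dim V / N ≥ 1/2 because each basis polynomial has unit L_2 norm.
  let f : (Fin d → ℝ) → ℝ := fun x => N⁻¹ * ∑ r, ‖inner ℂ (w x) (b r : E)‖ ^ 2
  have hf0 : ∀ x, 0 ≤ f x := fun x => by positivity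
  have hf1 : ∀ x, f x ≤ 1 := fun x => by
    have := hb.sum_inner_products_le (w x) (s := univ)
    rw [hwn] at this
    simp only [f]
    rw [inv_mul_le_iff₀ hN0, mul_one]
    refine le_trans (le_of_eq ?_) this
    exact sum_congr rfl fun r _ => by rw [norm_inner_symm]
  set B : Finset (Fin d → ℤ) := {q ∈ freqCube d D | blockIndex q ≤ s} with hB
  have hspan : (fun x => (f x : ℂ)) ∈ Submodule.span ℂ (trigSystem d '' B) := by
    have hexp : (fun x => (f x : ℂ)) = ∑ r, ∑ k : Λ, ∑ l : Λ,
        ((N⁻¹ : ℝ) * ((b r : E) k * (starRingEnd ℂ) ((b r : E) l)) : ℂ) •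
          trigSystem d (k.1 - l.1) := by
      funext x
      simp only [f, Finset.sum_apply, Pi.smul_apply, smul_eq_mul]
      rw [Complex.ofReal_mul, Complex.ofReal_sum, mul_sum]
      refine sum_congr rfl fun r _ => ?_
      rw [← Complex.normSq_eq_norm_sq, ← Complex.mul_conj, hwi, map_sum, sum_mul_sum, mul_sum]
      refine sum_congr rfl fun k _ => ?_
      rw [mul_sum]
      refine sum_congr rfl fun l _ => ?_
      rw [map_mul, ← trigSystem_mul_conj]
      ring
    rw [hexp]
    refine sum_mem fun r _ => sum_mem fun k _ => sum_mem fun l _ =>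
      Submodule.smul_mem _ _ (Submodule.subset_span ⟨_, ?_, rfl⟩)
    have hlt : ∀ j, |(k.1 - l.1) j| < 2 ^ s j := fun j => by
      have hk := Finset.mem_Ico.1 (Fintype.mem_piFinset.1 k.2 j)
      have hl := Finset.mem_Ico.1 (Fintype.mem_piFinset.1 l.2 j)
      rw [Pi.sub_apply, abs_lt]
      constructor <;> linarith [hk.1, hk.2, hl.1, hl.2]
    refine mem_coe.2 (mem_filter.2 ⟨mem_freqCube.2 fun j => (hlt j).trans_le ?_,
      fun j => abs_lt_two_pow_iff.1 (hlt j)⟩)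
    exact_mod_cast hD j
  obtain ⟨c0, hc0⟩ := (Submodule.mem_span_image_finset_iff_exists_fun' ℂ).1 hspan
  set c : (Fin d → ℤ) → ℂ := fun q => if blockIndex q ≤ s then c0 q else 0 with hc
  have hcf : ∀ x, ∑ q ∈ freqCube d D, c q * trigSystem d q x = f x := fun x => by
    rw [← congrFun hc0 x, Finset.sum_apply, hB, sum_filter]
    simp only [Pi.smul_apply, smul_eq_mul]
    refine sum_congr rfl fun q _ => ?_
    simp only [hc]
    split_ifs <;> simp
  have hD0 : 0 ∉ freqCube d D → c 0 = 0 := fun h => absurd (mem_freqCube.2 fun j => by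
    have := (Nat.two_pow_pos (s j)).trans_le (hD j)
    simpa using this) h
  refine ⟨c, fun q hq => if_neg hq, fun i => ?_, ?_, ?_⟩
  · rw [hcf]; simp [f, hbξ]
  · rw [← integral_norm_sum_trigSystem_sq]
    simp only [hcf, Complex.norm_real]
    calc _ ≤ ∫ _x, (1 : ℝ) ∂torusMeasure d := by
          refine integral_mono_of_nonneg (ae_of_all _ fun x => by positivity)
            (integrable_const _) (ae_of_all _ fun x => ?_)
          simp only [Real.norm_of_nonneg (hf0 x)]
          exact pow_le_one₀ (hf0 x) (hf1 x)
      _ = 1 := by simp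
  · have h1 : c 0 = ((∫ x, f x ∂torusMeasure d : ℝ) : ℂ) := by
      rw [← integral_sum_trigSystem _ c hD0, ← integral_complex_ofReal]
      simp only [hcf]
    rw [h1, Complex.ofReal_re]
    have h2 : ∀ r, ∫ x, ‖inner ℂ (w x) (b r : E)‖ ^ 2 ∂torusMeasure d = 1 := fun r => by
      set cr : (Fin d → ℤ) → ℂ := fun k => if h : k ∈ Λ then (b r : E) ⟨k, h⟩ else 0 with hcr
      have h3 : ∀ x, inner ℂ (w x) (b r : E) = ∑ k ∈ Λ, cr k * trigSystem d k x := fun x => by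
        rw [hwi, ← sum_coe_sort Λ]
        exact sum_congr rfl fun k _ => by simp [hcr]
      simp only [h3, integral_norm_sum_trigSystem_sq]
      rw [← sum_coe_sort Λ]
      have h4 := hb.1 r
      have h5 : ‖(b r : E)‖ ^ 2 = 1 := by rw [h4]; norm_num
      rw [EuclideanSpace.norm_sq_eq] at h5
      rw [← h5]
      exact sum_congr rfl fun k _ => by simp [hcr]
    simp only [f]
    rw [integral_const_mul, integral_finsetSum]
    · simp only [h2, sum_const, card_univ, Fintype.card_fin, nsmul_eq_mul, mul_one]
      rw [inv_mul_eq_div, div_le_div_iff₀ two_pos hN0]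
      linarith
    · intro r _
      refine integrable_of_continuous ?_
      simp only [hwi]
      exact ((continuous_finsetSum _ fun k _ =>
        continuous_const.mul (continuous_trigSystem d k.1)).norm).pow 2

/-! ### Growth estimates and counting of multi-indices -/

theorem exists_rpow_le_two_rpow (E : ℝ) {δ : ℝ} (hδ : 0 < δ) :
    ∃ C : ℝ, 0 < C ∧ ∀ l : ℕ, ((l : ℝ) + 1) ^ E ≤ C * 2 ^ (δ * l) := by
  have hb : 0 < δ * Real.log 2 := mul_pos hδ (Real.log_pos one_lt_two)
  have h1 := (tendsto_rpow_mul_exp_neg_mul_atTop_nhds_zero E _ hb).comp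
    (tendsto_natCast_atTop_atTop (R := ℝ)) |>.comp (Filter.tendsto_add_atTop_nat 1)
  obtain ⟨C, hC⟩ := h1.bddAbove_range
  refine ⟨max C 1 * 2 ^ δ, by positivity, fun l => ?_⟩
  have h2 := hC ⟨l, rfl⟩
  simp only [Function.comp_apply] at h2
  push_cast at h2
  have h3 : (2 : ℝ) ^ δ * 2 ^ (δ * l) = Real.exp (δ * Real.log 2 * (l + 1)) := by
    rw [← Real.rpow_add two_pos, Real.rpow_def_of_pos two_pos]; congr 1; ring
  rw [mul_assoc, h3]
  rw [neg_mul, Real.exp_neg, ← div_eq_mul_inv, div_le_iff₀ (Real.exp_pos _)] at h2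
  exact h2.trans (mul_le_mul_of_nonneg_right (le_max_left _ _) (Real.exp_pos _).le)

/-- The ratio of the two maxima lies between 1 and n - j + 1; using |γ| covers both signs of `γ`. -/
theorem rpow_max_one_le (γ : ℝ) {j n : ℕ} (hjn : j ≤ n) :
    ((max n 1 : ℕ) : ℝ) ^ γ ≤ ((max j 1 : ℕ) : ℝ) ^ γ * (((n - j : ℕ) : ℝ) + 1) ^ |γ| := by
  have hj : (0 : ℝ) < (max j 1 : ℕ) := by positivity
  have h1 : (1 : ℝ) ≤ (max n 1 : ℕ) / (max j 1 : ℕ) := by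
    rw [one_le_div hj]
    exact_mod_cast max_le_max hjn le_rfl
  have h2 : ((max n 1 : ℕ) : ℝ) / (max j 1 : ℕ) ≤ ((n - j : ℕ) : ℝ) + 1 := by
    rw [div_le_iff₀ hj]
    have : max n 1 ≤ (n - j + 1) * max j 1 := by
      obtain ⟨l, rfl⟩ := Nat.exists_eq_add_of_le hjn
      rw [Nat.add_sub_cancel_left]
      rcases Nat.eq_zero_or_pos j with rfl | hj
      · simp
      · rw [max_eq_left (by omega), max_eq_left (by omega)]
        nlinarith
    exact_mod_cast this
  have h3 : ((max n 1 : ℕ) : ℝ) = (max j 1 : ℕ) * ((max n 1 : ℕ) / (max j 1 : ℕ)) := by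
    field_simp
  rw [h3, Real.mul_rpow hj.le (by positivity)]
  refine mul_le_mul_of_nonneg_left ?_ (by positivity)
  exact (Real.rpow_le_rpow_of_exponent_le h1 (le_abs_self γ)).trans
    (Real.rpow_le_rpow (by positivity) h2 (abs_nonneg _))

theorem quasiNormA_sq_le {d : ℕ} {β : ℝ} (hβ0 : 0 < β) (hβ1 : β ≤ 1) (c : (Fin d → ℤ) → ℂ)
    (S : Finset (Fin d → ℤ)) :
    quasiNormA β c S ^ 2 ≤ (#S : ℝ) ^ (2 / β - 1) * ∑ k ∈ S, ‖c k‖ ^ 2 := by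
  have h1 := Real.rpow_sum_le_const_mul_sum_rpow S (fun k => ‖c k‖ ^ β) (p := 2 / β)
    (by rw [le_div_iff₀ hβ0]; linarith)
  have h2 : ∀ k, |‖c k‖ ^ β| ^ (2 / β) = ‖c k‖ ^ 2 := fun k => by
    rw [abs_of_nonneg (by positivity), ← Real.rpow_mul (norm_nonneg _),
      mul_div_cancel₀ _ hβ0.ne', Real.rpow_two]
  simp only [h2] at h1
  refine le_trans (le_of_eq ?_) h1
  rw [quasiNormA, ← Real.rpow_natCast, ← Real.rpow_mul (by positivity)]
  congr 1
  · exact sum_congr rfl fun k _ => (abs_of_nonneg (by positivity)).symm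
  · push_cast; ring

/-- The multi-indices with sum `n`. -/
def layer (d n : ℕ) : Finset (Fin d → ℕ) :=
  {s ∈ Fintype.piFinset fun _ => range (n + 1) | ∑ j, s j = n}

theorem mem_layer {d n : ℕ} {s : Fin d → ℕ} : s ∈ layer d n ↔ ∑ j, s j = n := by
  rw [layer, mem_filter, and_iff_right_iff_imp]
  rintro rfl
  exact Fintype.mem_piFinset.2 fun j => mem_range.2
    (Nat.lt_succ_of_le (single_le_sum (fun _ _ => Nat.zero_le _) (mem_univ j)))

/-- All coordinates but the first are free in [0, n/(e+1)]; the first makes up the sum. -/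
theorem le_card_layer (e n : ℕ) : (n / (e + 1) + 1) ^ e ≤ #(layer (e + 1) n) := by
  classical
  set q := n / (e + 1) with hq
  have hcard : #(Fintype.piFinset fun _ : Fin e => range (q + 1)) = (q + 1) ^ e := by simp
  rw [← hcard]
  refine card_le_card_of_injOn (fun t => Fin.cons (n - ∑ j, t j) t) (fun t ht => ?_)
    (fun t _ t' _ h => (Fin.cons_injective2 h).2)
  have h1 : ∑ j, t j ≤ n := by
    calc ∑ j, t j ≤ ∑ _j : Fin e, q := sum_le_sum fun j _ =>
          Nat.lt_succ_iff.1 (mem_range.1 (Fintype.mem_piFinset.1 (mem_coe.1 ht) j))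
      _ = e * q := by simp
      _ ≤ (e + 1) * q := by nlinarith
      _ ≤ n := Nat.mul_div_le n (e + 1)
  refine mem_coe.2 (mem_layer.2 ?_)
  rw [Fin.sum_univ_succ]
  simp only [Fin.cons_zero, Fin.cons_succ]
  omega

theorem card_layer_filter_le {d n : ℕ} (s' : Fin d → ℕ) :
    #{s ∈ layer d n | ∀ j, s' j ≤ s j} ≤ (n - ∑ j, s' j + 1) ^ d := by
  classical
  have : #(Fintype.piFinset fun j => Finset.Icc (s' j) (s' j + (n - ∑ j, s' j))) =
      (n - ∑ j, s' j + 1) ^ d := by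
    rw [Fintype.card_piFinset]
    simp [add_assoc]
  rw [← this]
  refine card_le_card fun s hs => Fintype.mem_piFinset.2 fun j => ?_
  obtain ⟨h1, h2⟩ := mem_filter.1 hs
  rw [mem_layer] at h1
  refine Finset.mem_Icc.2 ⟨h2 j, ?_⟩
  have h3 : s j - s' j ≤ ∑ i, (s i - s' i) :=
    single_le_sum (f := fun i => s i - s' i) (fun _ _ => Nat.zero_le _) (mem_univ j)
  have h4 : ∑ i, (s i - s' i) + ∑ i, s' i = ∑ i, s i := by
    rw [← sum_add_distrib]
    exact sum_congr rfl fun i _ => Nat.sub_add_cancel (h2 i)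
  omega

theorem blockIndex_le_imp_mem_freqCube {d n : ℕ} {q : Fin d → ℤ} {s : Fin d → ℕ}
    (hs : s ∈ layer d n) (hq : blockIndex q ≤ s) : q ∈ freqCube d (2 ^ n) :=
  mem_freqCube.2 fun j => by
    have : s j ≤ n := mem_layer.1 hs ▸ single_le_sum (fun _ _ => Nat.zero_le _) (mem_univ j)
    exact_mod_cast abs_lt_two_pow_iff.2 ((hq j).trans this)

/-- Only indices dominating `s'` contribute on its block; Cauchy–Schwarz over these costs their
number once more. -/
theorem sum_block_norm_sq_le {d n : ℕ} {c : (Fin d → ℕ) → (Fin d → ℤ) → ℂ}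
    (hc0 : ∀ s ∈ layer d n, ∀ q, ¬ blockIndex q ≤ s → c s q = 0)
    (hc1 : ∀ s ∈ layer d n, ∑ q ∈ freqCube d (2 ^ n), ‖c s q‖ ^ 2 ≤ 1) (s' : Fin d → ℕ) :
    ∑ q ∈ dyadicBlock s', ‖∑ s ∈ layer d n, c s q‖ ^ 2 ≤
      (#{s ∈ layer d n | ∀ j, s' j ≤ s j} : ℝ) ^ 2 := by
  classical
  set U := {s ∈ layer d n | ∀ j, s' j ≤ s j} with hU
  have h1 : ∀ q ∈ dyadicBlock s', ‖∑ s ∈ layer d n, c s q‖ ^ 2 ≤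
      #U * ∑ s ∈ U, ‖c s q‖ ^ 2 := fun q hq => by
    have : ∑ s ∈ layer d n, c s q = ∑ s ∈ U, c s q := by
      rw [hU, sum_filter]
      refine sum_congr rfl fun s hs => ?_
      split_ifs with h
      · rfl
      · exact hc0 s hs q fun h' => h (by rwa [mem_dyadicBlock.1 hq] at h')
    rw [this]
    exact (pow_le_pow_left₀ (norm_nonneg _) (norm_sum_le _ _) 2).trans sq_sum_le_card_mul_sum_sq
  calc _ ≤ ∑ q ∈ dyadicBlock s', #U * ∑ s ∈ U, ‖c s q‖ ^ 2 := sum_le_sum h1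
    _ = #U * ∑ s ∈ U, ∑ q ∈ dyadicBlock s', ‖c s q‖ ^ 2 := by rw [← mul_sum, sum_comm]
    _ ≤ #U * ∑ _s ∈ U, (1 : ℝ) := by
        refine mul_le_mul_of_nonneg_left (sum_le_sum fun s hs => ?_) (Nat.cast_nonneg _)
        obtain ⟨hsl, hs'⟩ := mem_filter.1 hs
        refine le_trans (sum_le_sum_of_subset_of_nonneg (fun q hq => ?_)
          fun _ _ _ => by positivity) (hc1 s hsl)
        exact blockIndex_le_imp_mem_freqCube hsl (by rwa [mem_dyadicBlock.1 hq])
    _ = _ := by simp [sq]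

/-! ### The lower bound -/

/-- Both `F` and `-F` have zero data, hence the same reconstruction `M 0`; the triangle inequality
for 2F gives the bound. -/
theorem le_optimalRecovery {X : Type*} [MeasurableSpace X] {Ω : Set X} {μ : Measure X} {m : ℕ}
    {W : Set (X → ℂ)} {p : ℝ≥0∞} (hp : 1 ≤ p) {r : ℝ≥0∞}
    (h : ∀ ξ : Fin m → Ω, ∃ F ∈ W, -F ∈ W ∧ (∀ i, F (ξ i) = 0) ∧ AEStronglyMeasurable F μ ∧
      r ≤ eLpNorm F p μ) : r ≤ optimalRecovery Ω μ m W p := by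
  refine le_iInf₂ fun ξ M => ?_
  obtain ⟨F, hF, hF', hξ, hFm, hr⟩ := h ξ
  set R := ⨆ f ∈ W, eLpNorm (fun x => f x - M (fun i => f (ξ i)) x) p μ with hR
  let g : X → ℂ := ⇑(M 0)
  have hgm : AEStronglyMeasurable g μ := Lp.aestronglyMeasurable _
  have h1 : eLpNorm (F - g) p μ ≤ R := by
    have := le_iSup₂ (f := fun f (_ : f ∈ W) =>
      eLpNorm (fun x => f x - M (fun i => f (ξ i)) x) p μ) F hF
    simp only [hξ] at this
    exact this
  have h2 : eLpNorm (-F - g) p μ ≤ R := by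
    have := le_iSup₂ (f := fun f (_ : f ∈ W) =>
      eLpNorm (fun x => f x - M (fun i => f (ξ i)) x) p μ) (-F) hF'
    simp only [Pi.neg_apply, hξ, neg_zero] at this
    exact this
  have h3 : eLpNorm ((2 : ℂ) • F) p μ ≤ R + R := by
    have : (2 : ℂ) • F = (F - g) - (-F - g) := by rw [two_smul]; abel
    rw [this]
    exact (eLpNorm_sub_le (hFm.sub hgm) (hFm.neg.sub hgm) hp).trans (add_le_add h1 h2)
  rw [eLpNorm_const_smul, ← two_mul] at h3
  have h4 : ‖(2 : ℂ)‖ₑ = 2 := by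
    rw [← ofReal_norm]; simp
  rw [h4] at h3
  exact hr.trans ((ENNReal.mul_le_mul_iff_right two_ne_zero ENNReal.ofNat_ne_top).1 h3)

theorem mem_classH_of_finite {d : ℕ} {a b β : ℝ} {C : (Fin d → ℤ) → ℂ} {S : Finset (Fin d → ℤ)}
    (hS : ∀ q ∉ S, C q = 0)
    (hC : ∀ s : Fin d → ℕ, quasiNormA β C (dyadicBlock s) ≤
      (2 : ℝ) ^ (-a * ((∑ j, s j : ℕ) : ℝ)) *
        ((max (∑ j, s j) 1 : ℕ) : ℝ) ^ (((d : ℝ) - 1) * b)) :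
    (fun x => ∑ q ∈ S, C q * trigSystem d q x) ∈ classH (torus d) (trigSystem d) a b β :=
  ⟨C, summable_of_ne_finset_zero (s := S) fun q hq => by rw [hS q hq, norm_zero],
    fun x _ => hasSum_sum_of_ne_finset_zero fun q hq => by rw [hS q hq, zero_mul], hC⟩

theorem exists_lower_bound (d : ℕ) (hd : 1 ≤ d) (a b β : ℝ) (ha : 0 < a) (hβ0 : 0 < β)
    (hβ1 : β ≤ 1) :
    ∃ c : ℝ, 0 < c ∧ ∀ m n : ℕ, 1 ≤ n → 2 * m ≤ 2 ^ n → ∀ p : ℝ≥0∞, 1 ≤ p →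
      ENNReal.ofReal (c * 2 ^ (-(a + 1 / β - 1 / 2) * n) * (n : ℝ) ^ (((d : ℝ) - 1) * (b + 1))) ≤
        recoveryH d a b β m p := by
  set δ := a + 1 / β - 1 / 2 with hδ
  set γ := ((d : ℝ) - 1) * b with hγ
  have hβi : 1 ≤ 1 / β := by rw [le_div_iff₀ hβ0]; linarith
  have hδ0 : 0 < δ := by linarith
  obtain ⟨C, hC0, hC⟩ := exists_rpow_le_two_rpow (d + |γ|) hδ0
  set K : ℝ := C * 2 ^ ((d : ℝ) * (1 / β - 1 / 2)) with hK
  have hK0 : 0 < K := by positivity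
  refine ⟨1 / (2 * K * d ^ (d - 1)), by positivity, fun m n hn hm p hp =>
    le_optimalRecovery hp fun ξ => ?_⟩
  have hcs : ∀ s : Fin d → ℕ, ∃ c : (Fin d → ℤ) → ℂ, s ∈ layer d n →
      (∀ q, ¬ (blockIndex q ≤ s) → c q = 0) ∧
      (∀ i, ∑ q ∈ freqCube d (2 ^ n), c q * trigSystem d q (ξ i) = 0) ∧
      ∑ q ∈ freqCube d (2 ^ n), ‖c q‖ ^ 2 ≤ 1 ∧ 1 / 2 ≤ (c 0).re := fun s => by
    by_cases hs : s ∈ layer d n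
    · have hsn := mem_layer.1 hs
      obtain ⟨c, hc⟩ := exists_fooling_coeffs (D := 2 ^ n) s (fun j =>
        Nat.pow_le_pow_right two_pos
          (hsn ▸ single_le_sum (fun _ _ => Nat.zero_le _) (mem_univ j)))
        (by rwa [hsn]) (fun i => (ξ i : Fin d → ℝ))
      exact ⟨c, fun _ => hc⟩
    · exact ⟨0, fun h => absurd h hs⟩
  choose cs hcs using hcs
  -- This is the amplitude at which the top level j = n fits the class. Passing from ℓ_2 to ℓ_β on a
  -- block costs 2^((j+d)(1/β-1/2)), which turns `a` into `δ`.
  set A : ℝ := 1 / K * 2 ^ (-δ * n) * (n : ℝ) ^ γ with hA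
  have hnR : (0 : ℝ) < n := by exact_mod_cast hn
  have hA0 : 0 < A := by positivity
  set G : (Fin d → ℤ) → ℂ := fun q => (A : ℂ) * ∑ s ∈ layer d n, cs s q with hG
  have hG0 : ∀ q ∉ freqCube d (2 ^ n), G q = 0 := fun q hq => by
    rw [hG]
    simp only
    rw [sum_eq_zero, mul_zero]
    exact fun s hs => (hcs s hs).1 q fun h => hq (blockIndex_le_imp_mem_freqCube hs h)
  have hGq : ∀ s : Fin d → ℕ, quasiNormA β G (dyadicBlock s) ≤
      (2 : ℝ) ^ (-a * ((∑ j, s j : ℕ) : ℝ)) * ((max (∑ j, s j) 1 : ℕ) : ℝ) ^ γ := fun s => by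
    set j := ∑ i, s i with hj
    set U := #{t ∈ layer d n | ∀ i, s i ≤ t i} with hU
    have hsq := quasiNormA_sq_le hβ0 hβ1 G (dyadicBlock s)
    have hb := sum_block_norm_sq_le (fun t ht => (hcs t ht).1) (fun t ht => (hcs t ht).2.2.1) s
    have hGs : ∑ q ∈ dyadicBlock s, ‖G q‖ ^ 2 ≤ (A * U) ^ 2 := by
      simp only [hG, norm_mul, mul_pow, ← mul_sum, Complex.norm_real, Real.norm_of_nonneg hA0.le]
      exact mul_le_mul_of_nonneg_left hb (sq_nonneg A)
    have hcard : (#(dyadicBlock s) : ℝ) ^ (2 / β - 1) ≤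
        ((2 : ℝ) ^ ((j + d : ℝ) * (1 / β - 1 / 2))) ^ 2 := by
      rw [← Real.rpow_natCast ((2 : ℝ) ^ _), ← Real.rpow_mul two_pos.le]
      have h1 : (#(dyadicBlock s) : ℝ) ≤ 2 ^ ((j : ℝ) + d) := by
        have := card_dyadicBlock_le s
        rw [← Nat.cast_add, Real.rpow_natCast]
        exact_mod_cast this
      refine (Real.rpow_le_rpow (by positivity) h1 ?_).trans (le_of_eq ?_)
      · have : 2 / β = 2 * (1 / β) := by ring
        linarith
      · rw [← Real.rpow_mul two_pos.le]; congr 1; push_cast; ring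
    have hq : quasiNormA β G (dyadicBlock s) ≤
        2 ^ ((j + d : ℝ) * (1 / β - 1 / 2)) * (A * U) := by
      refine le_of_sq_le_sq ?_ (by positivity)
      rw [mul_pow]
      exact hsq.trans (mul_le_mul hcard hGs (by positivity) (by positivity))
    refine hq.trans ?_
    by_cases hjn : j ≤ n
    · have hUle : (U : ℝ) ≤ (((n - j : ℕ) : ℝ) + 1) ^ (d : ℝ) := by
        rw [Real.rpow_natCast]; exact_mod_cast card_layer_filter_le s
      have h1 := rpow_max_one_le γ hjn
      rw [max_eq_left hn] at h1
      have h2 := hC (n - j)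
      rw [Real.rpow_add (by positivity)] at h2
      -- Lower levels have slack 2^(δ(n-j)), which pays for the overlap count and for replacing n^γ
      -- by the level-j weight.
      have h3 : (n : ℝ) ^ γ * U ≤ ((max j 1 : ℕ) : ℝ) ^ γ * (C * 2 ^ (δ * (n - j : ℕ))) := by
        calc (n : ℝ) ^ γ * U ≤ (((max j 1 : ℕ) : ℝ) ^ γ * (((n - j : ℕ) : ℝ) + 1) ^ |γ|) *
              (((n - j : ℕ) : ℝ) + 1) ^ (d : ℝ) := mul_le_mul h1 hUle (by positivity)
                (by positivity)
          _ = ((max j 1 : ℕ) : ℝ) ^ γ * ((((n - j : ℕ) : ℝ) + 1) ^ (d : ℝ) *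
              (((n - j : ℕ) : ℝ) + 1) ^ |γ|) := by ring
          _ ≤ _ := mul_le_mul_of_nonneg_left h2 (by positivity)
      have h4 : (2 : ℝ) ^ ((j + d : ℝ) * (1 / β - 1 / 2)) * (A * U) =
          (2 ^ ((j + d : ℝ) * (1 / β - 1 / 2)) * (1 / K * 2 ^ (-δ * n))) * ((n : ℝ) ^ γ * U) := by
        rw [hA]; ring
      rw [h4]
      refine (mul_le_mul_of_nonneg_left h3 (by positivity)).trans (le_of_eq ?_)
      have h5 : (2 : ℝ) ^ ((j + d : ℝ) * (1 / β - 1 / 2)) * 2 ^ (-δ * n) *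
          2 ^ (δ * (n - j : ℕ)) = 2 ^ (-a * (j : ℝ)) * 2 ^ ((d : ℝ) * (1 / β - 1 / 2)) := by
        rw [← Real.rpow_add two_pos, ← Real.rpow_add two_pos, ← Real.rpow_add two_pos,
          Nat.cast_sub hjn]
        congr 1; rw [hδ]; ring
      calc _ = (2 : ℝ) ^ ((j + d : ℝ) * (1 / β - 1 / 2)) * 2 ^ (-δ * n) *
          2 ^ (δ * (n - j : ℕ)) * (C / K) * ((max j 1 : ℕ) : ℝ) ^ γ := by ring
        _ = _ := by rw [h5, hK]; field_simp
    · have hU0 : U = 0 := by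
        rw [hU, card_eq_zero, filter_eq_empty_iff]
        intro t ht hst
        have := mem_layer.1 ht
        have h2 : ∑ i, s i ≤ ∑ i, t i := sum_le_sum fun i _ => hst i
        omega
      rw [hU0, Nat.cast_zero, mul_zero, mul_zero]
      positivity
  refine ⟨fun x => ∑ q ∈ freqCube d (2 ^ n), G q * trigSystem d q x,
    mem_classH_of_finite hG0 hGq, ?_, fun i => ?_, ?_, ?_⟩
  · have hneg : (-fun x => ∑ q ∈ freqCube d (2 ^ n), G q * trigSystem d q x) =
        fun x => ∑ q ∈ freqCube d (2 ^ n), (-G) q * trigSystem d q x := by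
      funext x; simp
    rw [hneg]
    refine mem_classH_of_finite (fun q hq => by simp [hG0 q hq]) fun s => ?_
    simpa [quasiNormA] using hGq s
  · simp only [hG, mul_sum, sum_mul]
    rw [sum_comm]
    refine sum_eq_zero fun s hs => ?_
    have := (hcs s hs).2.1 i
    simp only [mul_assoc, ← mul_sum, this, mul_zero]
  · exact (integrable_finsetSum _ fun q _ =>
      integrable_const_mul_trigSystem (G q) q).aestronglyMeasurable
  · have hFm : AEStronglyMeasurable (fun x => ∑ q ∈ freqCube d (2 ^ n), G q * trigSystem d q x)
        (torusMeasure d) := (integrable_finsetSum _ fun q _ =>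
      integrable_const_mul_trigSystem (G q) q).aestronglyMeasurable
    -- On a probability space the L_p norm dominates the L_1 norm, which dominates the modulus of
    -- the mean, that is, of the zeroth coefficient.
    refine le_trans ?_ (eLpNorm_le_eLpNorm_of_exponent_le hp hFm)
    rw [eLpNorm_one_eq_lintegral_enorm]
    refine le_trans ?_ (enorm_integral_le_lintegral_enorm _)
    rw [integral_sum_trigSystem _ G (hG0 0), ← ofReal_norm]
    refine ENNReal.ofReal_le_ofReal ?_
    refine le_trans ?_ (Complex.re_le_norm _)
    rw [hG]
    simp only
    rw [Complex.re_ofReal_mul, Complex.re_sum]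
    have h1 : (#(layer d n) : ℝ) * (1 / 2) ≤ ∑ s ∈ layer d n, (cs s 0).re := by
      rw [← nsmul_eq_mul]
      exact card_nsmul_le_sum _ _ _ fun s hs => (hcs s hs).2.2.2
    have h2 : (n : ℝ) ^ (d - 1) ≤ d ^ (d - 1) * #(layer d n) := by
      obtain ⟨e, rfl⟩ : ∃ e, d = e + 1 := ⟨d - 1, by omega⟩
      have h3 := le_card_layer e n
      have h4 : n ≤ (e + 1) * (n / (e + 1) + 1) := (Nat.lt_mul_div_succ n (by omega)).le
      have h5 : n ^ e ≤ (e + 1) ^ e * #(layer (e + 1) n) := by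
        calc n ^ e ≤ ((e + 1) * (n / (e + 1) + 1)) ^ e := Nat.pow_le_pow_left h4 e
          _ = (e + 1) ^ e * (n / (e + 1) + 1) ^ e := mul_pow _ _ _
          _ ≤ _ := Nat.mul_le_mul_left _ h3
      rw [Nat.add_sub_cancel]
      exact_mod_cast h5
    have hexp : (n : ℝ) ^ (((d : ℝ) - 1) * (b + 1)) = (n : ℝ) ^ γ * (n : ℝ) ^ (d - 1) := by
      rw [← Real.rpow_natCast, ← Real.rpow_add hnR, Nat.cast_sub hd]
      congr 1; rw [hγ]; push_cast; ring
    rw [hexp]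
    calc _ = A * ((n : ℝ) ^ (d - 1) / d ^ (d - 1) * (1 / 2)) := by
          rw [hA]; field_simp
      _ ≤ A * (#(layer d n) * (1 / 2)) := by
          refine mul_le_mul_of_nonneg_left (mul_le_mul_of_nonneg_right ?_ (by norm_num)) hA0.le
          rw [div_le_iff₀ (by positivity)]; linarith
      _ ≤ _ := mul_le_mul_of_nonneg_left h1 hA0.le

/-! ### Coefficients of differences: sparse and tail estimates -/

/-- The bound for the blocks of level `j` in the definition of the class. -/
noncomputable def blockBound (a γ : ℝ) (j : ℕ) : ℝ :=
  (2 : ℝ) ^ (-a * (j : ℝ)) * ((max j 1 : ℕ) : ℝ) ^ γ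

/-- The block condition satisfied by differences of two elements of the class. -/
def DiffBound {d : ℕ} (a γ β : ℝ) (h : (Fin d → ℤ) → ℂ) : Prop :=
  ∀ s : Fin d → ℕ, ∑ k ∈ dyadicBlock s, ‖h k‖ ^ β ≤ 2 * blockBound a γ (∑ j, s j) ^ β

theorem blockBound_pos (a γ : ℝ) (j : ℕ) : 0 < blockBound a γ j := by
  unfold blockBound; positivity

theorem blockBound_le (a γ : ℝ) (j : ℕ) :
    blockBound a γ j ≤ 2 ^ (-a * (j : ℝ)) * ((j : ℝ) + 1) ^ |γ| := by
  have := rpow_max_one_le γ (Nat.zero_le j)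
  simp only [zero_le, sup_of_le_right, Nat.cast_one, Real.one_rpow, one_mul, Nat.sub_zero] at this
  exact mul_le_mul_of_nonneg_left this (by positivity)

theorem rpow_norm_sub_le {β : ℝ} (hβ0 : 0 < β) (hβ1 : β ≤ 1) (x y : ℂ) :
    ‖x - y‖ ^ β ≤ ‖x‖ ^ β + ‖y‖ ^ β :=
  (Real.rpow_le_rpow (norm_nonneg _) (norm_sub_le x y) hβ0.le).trans
    (Real.rpow_add_le_add_rpow (norm_nonneg _) (norm_nonneg _) hβ0.le hβ1)

theorem sum_rpow_le_of_quasiNormA_le {d : ℕ} {β B : ℝ} (hβ0 : 0 < β) {c : (Fin d → ℤ) → ℂ}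
    {S : Finset (Fin d → ℤ)} (h : quasiNormA β c S ≤ B) : ∑ k ∈ S, ‖c k‖ ^ β ≤ B ^ β := by
  have h0 : 0 ≤ ∑ k ∈ S, ‖c k‖ ^ β := sum_nonneg fun _ _ => by positivity
  have := Real.rpow_le_rpow (Real.rpow_nonneg h0 _) h hβ0.le
  rwa [← Real.rpow_mul h0, one_div_mul_cancel hβ0.ne', Real.rpow_one] at this

theorem diffBound_sub {d : ℕ} {a γ β : ℝ} (hβ0 : 0 < β) (hβ1 : β ≤ 1) {c c' : (Fin d → ℤ) → ℂ}
    (hc : ∀ s : Fin d → ℕ, quasiNormA β c (dyadicBlock s) ≤ blockBound a γ (∑ j, s j))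
    (hc' : ∀ s : Fin d → ℕ, quasiNormA β c' (dyadicBlock s) ≤ blockBound a γ (∑ j, s j)) :
    DiffBound a γ β (c - c') := fun s => by
  calc _ ≤ ∑ k ∈ dyadicBlock s, (‖c k‖ ^ β + ‖c' k‖ ^ β) :=
        sum_le_sum fun k _ => rpow_norm_sub_le hβ0 hβ1 _ _
    _ ≤ _ := by
        rw [sum_add_distrib, two_mul]
        exact add_le_add (sum_rpow_le_of_quasiNormA_le hβ0 (hc s))
          (sum_rpow_le_of_quasiNormA_le hβ0 (hc' s))

/-- Interpolation between ℓ_β and ℓ_∞ through x = x^(1-β) x^β. -/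
theorem sum_le_of_sum_rpow_le {ι : Type*} {β S t : ℝ} (hβ1 : β ≤ 1) {F : Finset ι}
    {x : ι → ℝ} (hx : ∀ k, 0 ≤ x k) (hS : ∑ k ∈ F, x k ^ β ≤ S) (ht : 0 ≤ t)
    (hxt : ∀ k ∈ F, x k ≤ t) : ∑ k ∈ F, x k ≤ t ^ (1 - β) * S := by
  calc ∑ k ∈ F, x k ≤ ∑ k ∈ F, t ^ (1 - β) * x k ^ β := sum_le_sum fun k hk => by
        rcases (hx k).eq_or_lt with h0 | h0
        · rw [← h0]; positivity
        · calc x k = x k ^ (1 - β) * x k ^ β := by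
                rw [← Real.rpow_add h0, sub_add_cancel, Real.rpow_one]
            _ ≤ _ := by
                refine mul_le_mul_of_nonneg_right ?_ (by positivity)
                exact Real.rpow_le_rpow h0.le (hxt k hk) (by linarith)
    _ ≤ _ := by rw [← mul_sum]; exact mul_le_mul_of_nonneg_left hS (by positivity)

theorem sum_le_rpow_of_sum_rpow_le {ι : Type*} {β S : ℝ} (hβ0 : 0 < β) (hβ1 : β ≤ 1)
    {F : Finset ι} {x : ι → ℝ} (hx : ∀ k, 0 ≤ x k) (hS0 : 0 < S) (hS : ∑ k ∈ F, x k ^ β ≤ S) :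
    ∑ k ∈ F, x k ≤ S ^ (1 / β) := by
  refine (sum_le_of_sum_rpow_le hβ1 hx hS (t := S ^ (1 / β)) (by positivity) fun k hk => ?_).trans
    (le_of_eq ?_)
  · have h1 := (single_le_sum (f := fun k => x k ^ β) (fun k _ => Real.rpow_nonneg (hx k) _)
      hk).trans hS
    have h2 := Real.rpow_le_rpow (Real.rpow_nonneg (hx k) _) h1 (z := 1 / β) (by positivity)
    rwa [← Real.rpow_mul (hx k), mul_one_div_cancel hβ0.ne', Real.rpow_one] at h2
  · nth_rewrite 2 [← Real.rpow_one S]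
    rw [← Real.rpow_mul hS0.le, ← Real.rpow_add hS0]
    congr 1
    field_simp
    ring

/-- An `ℓ_1` bound for the sum of a vector of small support and a vector of small
`ℓ_β` quasi-norm. -/
theorem sum_le_sqrt_mul_add {ι : Type*} [DecidableEq ι] {β S v : ℝ} (hβ0 : 0 < β) (hβ1 : β ≤ 1)
    (hS0 : 0 < S) (hv : 0 < v) {Q low : Finset ι} (hlow : low ⊆ Q) (hcard : (#low : ℝ) ≤ v)
    {x : ι → ℝ} (hx : ∀ k, 0 ≤ x k) (hS : ∑ k ∈ Q \ low, x k ^ β ≤ S) :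
    ∑ k ∈ Q, x k ≤ √(2 * v) * √(∑ k ∈ Q, x k ^ 2) + S ^ (1 / β) * v ^ (1 - 1 / β) := by
  -- By Chebyshev at most `v` entries outside `low` exceed this threshold. Cauchy–Schwarz handles
  -- them together with `low`, at most 2v entries; the rest are interpolated.
  set t := (S / v) ^ (1 / β) with ht
  have ht0 : 0 < t := by positivity
  have htβ : t ^ β = S / v := by
    rw [ht, ← Real.rpow_mul (by positivity), one_div_mul_cancel hβ0.ne', Real.rpow_one]
  set A := {k ∈ Q \ low | t < x k} with hA
  have hAcard : (#A : ℝ) ≤ v := by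
    have h1 : #A * t ^ β ≤ S := by
      refine le_trans ?_ hS
      rw [← nsmul_eq_mul]
      refine (card_nsmul_le_sum A (fun k => x k ^ β) _ fun k hk =>
        Real.rpow_le_rpow ht0.le (mem_filter.1 hk).2.le hβ0.le).trans ?_
      exact sum_le_sum_of_subset_of_nonneg (filter_subset _ _)
        fun k _ _ => Real.rpow_nonneg (hx k) _
    rw [htβ, ← mul_div_assoc, div_le_iff₀ hv, mul_comm S] at h1
    exact le_of_mul_le_mul_right h1 hS0
  have h1 : ∑ k ∈ low ∪ A, x k ≤ √(2 * v) * √(∑ k ∈ Q, x k ^ 2) := by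
    rw [← Real.sqrt_mul (by positivity)]
    refine Real.le_sqrt_of_sq_le (sq_sum_le_card_mul_sum_sq.trans ?_)
    refine mul_le_mul ?_ ?_ (sum_nonneg fun _ _ => sq_nonneg _) (by positivity)
    · have : (#(low ∪ A) : ℝ) ≤ #low + #A := by exact_mod_cast card_union_le low A
      linarith
    · exact sum_le_sum_of_subset_of_nonneg
        (union_subset hlow ((filter_subset _ _).trans sdiff_subset)) fun _ _ _ => sq_nonneg _
  have h2 : ∑ k ∈ (Q \ low) \ A, x k ≤ S ^ (1 / β) * v ^ (1 - 1 / β) := by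
    refine (sum_le_of_sum_rpow_le hβ1 hx ((sum_le_sum_of_subset_of_nonneg sdiff_subset
      fun k _ _ => Real.rpow_nonneg (hx k) _).trans hS) ht0.le fun k hk => ?_).trans (le_of_eq ?_)
    · by_contra hcon
      obtain ⟨hk1, hk2⟩ := mem_sdiff.1 hk
      exact hk2 (mem_filter.2 ⟨hk1, not_le.1 hcon⟩)
    · rw [ht, ← Real.rpow_mul (by positivity), Real.div_rpow hS0.le hv.le, div_eq_mul_inv,
        ← Real.rpow_neg hv.le]
      have e1 : S ^ (1 / β * (1 - β)) * S = S ^ (1 / β) := by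
        nth_rewrite 2 [← Real.rpow_one S]
        rw [← Real.rpow_add hS0]
        congr 1
        field_simp
        ring
      have e2 : -(1 / β * (1 - β)) = 1 - 1 / β := by field_simp; ring
      rw [e2, ← e1]
      ring
  have h3 : ∑ k ∈ Q, x k = ∑ k ∈ low ∪ A, x k + ∑ k ∈ (Q \ low) \ A, x k := by
    rw [sdiff_sdiff_left, add_comm]
    exact (sum_sdiff (union_subset hlow ((filter_subset _ _).trans sdiff_subset))).symm
  linarith

/-- The ℓ_1 norm of a block is at most its ℓ_β quasi-norm. Half of the decay 2^(-aJ) absorbs the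
polynomial weight, a quarter gives the factor in `n`, and a quarter makes a product of geometric
series over `s`. -/
theorem exists_tail_bound (d : ℕ) {a β : ℝ} (γ : ℝ) (ha : 0 < a) (hβ0 : 0 < β) (hβ1 : β ≤ 1) :
    ∃ C : ℝ, 0 < C ∧ ∀ h : (Fin d → ℤ) → ℂ, DiffBound a γ β h → ∀ (n : ℕ)
      (F : Finset (Fin d → ℤ)), (∀ k ∈ F, n ≤ ∑ j, blockIndex k j) →
      ∑ k ∈ F, ‖h k‖ ≤ C * 2 ^ (-(a / 4) * (n : ℝ)) := by
  classical
  obtain ⟨C, hC0, hC⟩ := exists_rpow_le_two_rpow |γ| (half_pos ha)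
  set q : ℝ := 2 ^ (-(a / 4)) with hq
  have hq0 : 0 < q := by positivity
  have hq1 : q < 1 := Real.rpow_lt_one_of_one_lt_of_neg one_lt_two (by linarith)
  have hq1' : 0 < 1 - q := by linarith
  refine ⟨2 ^ (1 / β) * C * (1 - q)⁻¹ ^ d, by positivity, fun h hh n F hF => ?_⟩
  set N := F.sup (fun k => ∑ j, blockIndex k j) + 1 with hN
  set I : Finset (Fin d → ℕ) := Fintype.piFinset fun _ => range N with hI
  have hmaps : ∀ k ∈ F, blockIndex k ∈ I := fun k hk => Fintype.mem_piFinset.2 fun j => by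
    rw [mem_range, hN, Nat.lt_succ_iff]
    exact (single_le_sum (f := fun j => blockIndex k j) (fun _ _ => Nat.zero_le _)
      (mem_univ j)).trans (le_sup (f := fun k => ∑ j, blockIndex k j) hk)
  have hblock : ∀ s ∈ I, ∑ k ∈ F with blockIndex k = s, ‖h k‖ ≤
      2 ^ (1 / β) * C * 2 ^ (-(a / 4) * (n : ℝ)) * ∏ j, q ^ s j := fun s _ => by
    set J := ∑ j, s j with hJ
    have hprod : ∏ j, q ^ s j = 2 ^ (-(a / 4) * (J : ℝ)) := by
      rw [prod_pow_eq_pow_sum, hq, Real.rpow_mul two_pos.le, Real.rpow_natCast]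
    by_cases hnJ : n ≤ J
    · calc _ ≤ ∑ k ∈ dyadicBlock s, ‖h k‖ := by
            refine sum_le_sum_of_subset_of_nonneg (fun k hk => ?_) fun _ _ _ => norm_nonneg _
            exact mem_dyadicBlock.2 (mem_filter.1 hk).2
        _ ≤ (2 * blockBound a γ J ^ β) ^ (1 / β) := by
            have := blockBound_pos a γ J
            exact sum_le_rpow_of_sum_rpow_le hβ0 hβ1 (fun _ => norm_nonneg _) (by positivity) (hh s)
        _ = 2 ^ (1 / β) * blockBound a γ J := by
            have := blockBound_pos a γ J
            rw [Real.mul_rpow two_pos.le (by positivity), ← Real.rpow_mul this.le,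
              mul_one_div_cancel hβ0.ne', Real.rpow_one]
        _ ≤ 2 ^ (1 / β) * (2 ^ (-a * (J : ℝ)) * (C * 2 ^ (a / 2 * J))) := by
            refine mul_le_mul_of_nonneg_left ((blockBound_le a γ J).trans ?_) (by positivity)
            exact mul_le_mul_of_nonneg_left (hC J) (by positivity)
        _ = 2 ^ (1 / β) * C * (2 ^ (-(a / 4) * (J : ℝ)) * 2 ^ (-(a / 4) * (J : ℝ))) := by
            have : (2 : ℝ) ^ (-a * (J : ℝ)) * 2 ^ (a / 2 * J) =
                2 ^ (-(a / 4) * (J : ℝ)) * 2 ^ (-(a / 4) * (J : ℝ)) := by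
              rw [← Real.rpow_add two_pos, ← Real.rpow_add two_pos]; congr 1; ring
            rw [← this]; ring
        _ ≤ 2 ^ (1 / β) * C * (2 ^ (-(a / 4) * (n : ℝ)) * 2 ^ (-(a / 4) * (J : ℝ))) := by
            refine mul_le_mul_of_nonneg_left (mul_le_mul_of_nonneg_right ?_ (by positivity))
              (by positivity)
            refine Real.rpow_le_rpow_of_exponent_le one_le_two ?_
            have : (n : ℝ) ≤ J := by exact_mod_cast hnJ
            nlinarith
        _ = _ := by rw [hprod]; ring
    · rw [sum_eq_zero]
      · positivity
      · intro k hk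
        obtain ⟨h1, h2⟩ := mem_filter.1 hk
        have := hF k h1
        rw [h2] at this
        exact absurd this hnJ
  calc ∑ k ∈ F, ‖h k‖ = ∑ s ∈ I, ∑ k ∈ F with blockIndex k = s, ‖h k‖ :=
        (sum_fiberwise_of_maps_to hmaps _).symm
    _ ≤ ∑ s ∈ I, 2 ^ (1 / β) * C * 2 ^ (-(a / 4) * (n : ℝ)) * ∏ j, q ^ s j := sum_le_sum hblock
    _ = 2 ^ (1 / β) * C * 2 ^ (-(a / 4) * (n : ℝ)) * (∑ i ∈ range N, q ^ i) ^ d := by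
        rw [← mul_sum, hI, sum_prod_piFinset (range N) fun _ i => q ^ i]
        simp
    _ ≤ 2 ^ (1 / β) * C * 2 ^ (-(a / 4) * (n : ℝ)) * (1 - q)⁻¹ ^ d := by
        refine mul_le_mul_of_nonneg_left (pow_le_pow_left₀ (sum_nonneg fun _ _ => by positivity)
          ?_ d) (by positivity)
        rw [← tsum_geometric_of_lt_one hq0.le hq1]
        exact (summable_geometric_of_lt_one hq0.le hq1).sum_le_tsum _ fun _ _ => by positivity
    _ = _ := by ring

theorem norm_sub_sum_le_of_hasSum {ι : Type*} {g : ι → ℂ} {z : ℂ} {ε : ℝ}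
    {Q : Finset ι} (hg : HasSum g z) (hε : ∀ F : Finset ι, Disjoint F Q → ∑ k ∈ F, ‖g k‖ ≤ ε) :
    ‖z - ∑ k ∈ Q, g k‖ ≤ ε := by
  classical
  refine le_of_tendsto (hg.sub_const _).norm ?_
  filter_upwards [Filter.eventually_ge_atTop Q] with F hF
  rw [← sum_sdiff hF, add_sub_cancel_right]
  exact (norm_sum_le _ _).trans (hε _ sdiff_disjoint)

/-- Arbitrary maps are allowed, so the reconstruction may be any class element consistent with the
data. -/
theorem optimalRecovery_le {X : Type*} [MeasurableSpace X] {Ω : Set X} {μ : Measure X} {m : ℕ}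
    {W : Set (X → ℂ)} {p : ℝ≥0∞} {r : ℝ≥0∞} (hW : ∀ f ∈ W, MemLp f p μ) (ξ : Fin m → Ω)
    (h : ∀ f ∈ W, ∀ g ∈ W, (∀ i, f (ξ i) = g (ξ i)) → eLpNorm (f - g) p μ ≤ r) :
    optimalRecovery Ω μ m W p ≤ r := by
  classical
  let M : (Fin m → ℂ) → Lp ℂ p μ := fun y =>
    if hy : ∃ g ∈ W, (fun i => g (ξ i)) = y then (hW hy.choose hy.choose_spec.1).toLp _ else 0
  refine (iInf₂_le ξ M).trans (iSup₂_le fun f hf => ?_)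
  have hy : ∃ g ∈ W, (fun i => g (ξ i)) = fun i => f (ξ i) := ⟨f, hf, rfl⟩
  have hM : M (fun i => f (ξ i)) = (hW hy.choose hy.choose_spec.1).toLp _ := dif_pos hy
  rw [hM]
  have hae : (fun x => f x - (hW hy.choose hy.choose_spec.1).toLp _ x) =ᵐ[μ]
      f - hy.choose := by
    filter_upwards [(hW hy.choose hy.choose_spec.1).coeFn_toLp] with x hx
    rw [hx, Pi.sub_apply]
  rw [eLpNorm_congr_ae hae]
  exact h f hf _ hy.choose_spec.1 fun i => (congrFun hy.choose_spec.2 i).symm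

theorem ae_mem_torus (d : ℕ) : ∀ᵐ x ∂torusMeasure d, x ∈ torus d := by
  rw [torusMeasure]
  exact Measure.ae_smul_measure (ae_restrict_mem measurableSet_Icc) _

theorem memLp_of_mem_classH {d : ℕ} {a b β : ℝ} {f : (Fin d → ℝ) → ℂ}
    (hf : f ∈ classH (torus d) (trigSystem d) a b β) (p : ℝ≥0∞) : MemLp f p (torusMeasure d) := by
  obtain ⟨c, hc, hsum, -⟩ := hf
  have hn : ∀ k x, ‖c k * trigSystem d k x‖ ≤ ‖c k‖ := fun k x => by
    rw [norm_mul, norm_trigSystem, mul_one]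
  have hcont : Continuous fun x => ∑' k, c k * trigSystem d k x :=
    continuous_tsum (fun k => continuous_const.mul (continuous_trigSystem d k)) hc hn
  have hae : f =ᵐ[torusMeasure d] fun x => ∑' k, c k * trigSystem d k x := by
    filter_upwards [ae_mem_torus d] with x hx using (hsum x hx).tsum_eq.symm
  refine (memLp_congr_ae hae).2 (MemLp.of_bound hcont.aestronglyMeasurable (∑' k, ‖c k‖)
    (ae_of_all _ fun x => tsum_of_norm_bounded hc.hasSum fun k => hn k x))

/-! ### The upper bound at level n -/

theorem exists_trig_norming_points (d n L : ℕ) :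
    ∃ P : Finset (torus d), #P ≤ (L + 1) ^ 2 * 4 ^ L * (8192 * ((n + 1) * d + 3)) ^ 2 ∧
      ∀ c : (Fin d → ℤ) → ℂ, ∑ k ∈ freqCube d (2 ^ n), ‖c k‖ ≤ 2 ^ L →
        ∑ k ∈ freqCube d (2 ^ n), ‖c k‖ ^ 2 = 1 →
        ∃ x ∈ P, 1 / 4 ≤ ‖∑ k ∈ freqCube d (2 ^ n), c k * trigSystem d k x‖ := by
  classical
  set D := 2 ^ n with hD
  have hD0 : 0 < D := by positivity
  have : Nonempty (Fin (2 * D)) := ⟨⟨0, by omega⟩⟩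
  set q := 8192 * ((n + 1) * d + 3) with hq
  have hG : Fintype.card (Fin d → Fin (2 * D)) = 2 ^ ((n + 1) * d) := by
    rw [Fintype.card_fun, Fintype.card_fin, Fintype.card_fin, hD, ← pow_succ', ← pow_mul]
  have hι : Fintype.card (freqCube d D) ≤ 2 ^ ((n + 1) * d) := by
    rw [Fintype.card_coe, freqCube, Fintype.card_piFinset]
    simp only [Int.card_Ioo, prod_const, card_univ, Fintype.card_fin]
    rw [pow_mul]
    refine Nat.pow_le_pow_left ?_ d
    rw [pow_succ]
    omega
  have hlog2 : Real.log 2 < 1 := Real.log_two_lt_d9.trans (by norm_num)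
  have hlog : ∀ t : ℕ, Real.log (2 ^ t) ≤ t := fun t => by
    rw [Real.log_pow]
    exact mul_le_of_le_one_right (Nat.cast_nonneg t) hlog2.le
  have hA : 8192 * Real.log (4 * Fintype.card (Fin d → Fin (2 * D))) ≤ q := by
    rw [hG]
    have h1 := hlog ((n + 1) * d + 2)
    have h2 : (4 : ℝ) * ((2 ^ ((n + 1) * d) : ℕ) : ℝ) = 2 ^ ((n + 1) * d + 2) := by
      push_cast; ring
    rw [h2, hq]
    push_cast at h1 ⊢
    linarith
  have hB : 2 * Real.log (4 * Fintype.card (freqCube d D) + 1) < q := by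
    have h1 := hlog ((n + 1) * d + 3)
    have h2 : (4 : ℝ) * Fintype.card (freqCube d D) + 1 ≤ 2 ^ ((n + 1) * d + 3) := by
      have h3 : 4 * Fintype.card (freqCube d D) + 1 ≤ 2 ^ ((n + 1) * d + 3) := by
        have := Nat.one_le_two_pow (n := (n + 1) * d)
        rw [pow_add]
        omega
      exact_mod_cast h3
    have h4 := Real.log_le_log (by positivity) h2
    have h5 : (0 : ℝ) < ((n + 1) * d + 3 : ℕ) := by positivity
    rw [hq]
    push_cast at h1 h5 ⊢
    linarith
  obtain ⟨P, hP, hPc⟩ := exists_norming_points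
    (e := fun (k : freqCube d D) (g : Fin d → Fin (2 * D)) =>
      trigSystem d k.1 (gridPoint (2 * D) g)) (L := L) (fun k x => (norm_trigSystem _ _ _).le)
    (fun c => by
      have := sum_grid_norm_sq (D := D) (fun k => if h : k ∈ freqCube d D then c ⟨k, h⟩ else 0)
      simp only [← sum_coe_sort (freqCube d D)] at this
      simp only [coe_mem, dif_pos, Subtype.coe_eta] at this
      rw [this, Fintype.card_fun, Fintype.card_fin, Fintype.card_fin]
      push_cast
      rfl) hA hB
  refine ⟨P.image fun g => ⟨gridPoint (2 * D) g, gridPoint_mem_torus _ g⟩,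
    card_image_le.trans (hP.trans (le_of_eq (by ring))), fun c hc hc2 => ?_⟩
  rw [← sum_coe_sort] at hc hc2
  obtain ⟨x, hx, hx'⟩ := hPc (fun k => c k.1) hc hc2
  refine ⟨_, mem_image_of_mem _ hx, ?_⟩
  rw [← sum_coe_sort]
  exact hx'

theorem exists_map_covering {α : Type*} [Nonempty α] (P : Finset α) {m : ℕ} (hm : #P ≤ m) :
    ∃ ξ : Fin m → α, ∀ x ∈ P, ∃ i, ξ i = x := by
  classical
  refine ⟨fun i => if h : (i : ℕ) < #P then (P.equivFin.symm ⟨i, h⟩ : α)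
    else Classical.arbitrary α, fun x hx => ?_⟩
  refine ⟨⟨P.equivFin ⟨x, hx⟩, (P.equivFin ⟨x, hx⟩).2.trans_le hm⟩, ?_⟩
  simp

theorem card_low_le (d n n1 : ℕ) :
    #{k ∈ freqCube d (2 ^ n1) | ∑ j, blockIndex k j ≤ n} ≤ 2 ^ (n + d) * (n + 1) ^ d := by
  classical
  set low := {k ∈ freqCube d (2 ^ n1) | ∑ j, blockIndex k j ≤ n} with hlow
  set I : Finset (Fin d → ℕ) := Fintype.piFinset fun _ => range (n + 1) with hI
  have hmaps : ∀ k ∈ low, blockIndex k ∈ I := fun k hk => Fintype.mem_piFinset.2 fun j =>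
    mem_range.2 (Nat.lt_succ_of_le ((single_le_sum (f := fun j => blockIndex k j)
      (fun _ _ => Nat.zero_le _) (mem_univ j)).trans (mem_filter.1 hk).2))
  have hI' : #I = (n + 1) ^ d := by simp [hI]
  rw [← hI']
  refine card_le_mul_card_image_of_maps_to hmaps _ fun s _ => ?_
  by_cases hs : ∑ j, s j ≤ n
  · calc _ ≤ #(dyadicBlock s) := card_le_card fun k hk => mem_dyadicBlock.2 (mem_filter.1 hk).2
      _ ≤ 2 ^ (∑ j, s j + d) := card_dyadicBlock_le s
      _ ≤ _ := Nat.pow_le_pow_right two_pos (by omega)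
  · rw [filter_eq_empty_iff.2, card_empty]
    · exact Nat.zero_le _
    · intro k hk hks
      exact hs (hks ▸ (mem_filter.1 hk).2)

/-- The cube meets at most (n1+1)^d blocks, all of level at most d·n1; the remaining ones have level
above `n`, which gives the decay. -/
theorem sum_high_le {d : ℕ} {a γ β : ℝ} (ha : 0 < a) (hβ0 : 0 < β) {h : (Fin d → ℤ) → ℂ}
    (hh : DiffBound a γ β h) (n n1 : ℕ) :
    ∑ k ∈ freqCube d (2 ^ n1) \ {k ∈ freqCube d (2 ^ n1) | ∑ j, blockIndex k j ≤ n}, ‖h k‖ ^ β ≤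
      ((n1 : ℝ) + 1) ^ d *
        (2 * (2 ^ (-a * (n : ℝ)) * ((d : ℝ) * n1 + 1) ^ |γ|) ^ β) := by
  classical
  set H := freqCube d (2 ^ n1) \ {k ∈ freqCube d (2 ^ n1) | ∑ j, blockIndex k j ≤ n} with hH
  set I : Finset (Fin d → ℕ) := Fintype.piFinset fun _ => range (n1 + 1) with hI
  have hmaps : ∀ k ∈ H, blockIndex k ∈ I := fun k hk => Fintype.mem_piFinset.2 fun j => by
    rw [mem_range, Nat.lt_succ_iff, blockIndex, ← abs_lt_two_pow_iff]
    exact_mod_cast mem_freqCube.1 (mem_sdiff.1 hk).1 j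
  have hI' : #I = (n1 + 1) ^ d := by simp [hI]
  rw [← sum_fiberwise_of_maps_to hmaps]
  refine (sum_le_card_nsmul I _ (2 * (2 ^ (-a * (n : ℝ)) * ((d : ℝ) * n1 + 1) ^ |γ|) ^ β)
    fun s hs => ?_).trans (le_of_eq (by rw [hI', nsmul_eq_mul]; push_cast; ring))
  set J := ∑ j, s j with hJ
  by_cases hnJ : n < J
  · calc _ ≤ ∑ k ∈ dyadicBlock s, ‖h k‖ ^ β := by
          refine sum_le_sum_of_subset_of_nonneg (fun k hk => ?_) fun _ _ _ => by positivity
          exact mem_dyadicBlock.2 (mem_filter.1 hk).2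
      _ ≤ 2 * blockBound a γ J ^ β := hh s
      _ ≤ _ := by
          refine mul_le_mul_of_nonneg_left (Real.rpow_le_rpow (blockBound_pos _ _ _).le
            ((blockBound_le a γ J).trans ?_) hβ0.le) two_pos.le
          have h1 : J ≤ d * n1 := by
            have : ∑ j, s j ≤ ∑ _j : Fin d, n1 := sum_le_sum fun j _ =>
              Nat.lt_succ_iff.1 (mem_range.1 (Fintype.mem_piFinset.1 hs j))
            simpa using this
          have h2 : (J : ℝ) ≤ d * n1 := by exact_mod_cast h1
          have h3 : (n : ℝ) ≤ J := by exact_mod_cast hnJ.le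
          refine mul_le_mul (Real.rpow_le_rpow_of_exponent_le one_le_two (by nlinarith))
            (Real.rpow_le_rpow (by positivity) (by linarith) (abs_nonneg _)) (by positivity)
            (by positivity)
  · rw [sum_eq_zero]
    · positivity
    · intro k hk
      obtain ⟨h1, h2⟩ := mem_filter.1 hk
      obtain ⟨h3, h4⟩ := mem_sdiff.1 h1
      refine absurd (mem_filter.2 ⟨h3, ?_⟩) h4
      rw [h2]
      exact not_lt.1 hnJ

theorem eLpNorm_le_of_approx {d : ℕ} {f : (Fin d → ℝ) → ℂ} {h : (Fin d → ℤ) → ℂ}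
    {Q : Finset (Fin d → ℤ)} {ε : ℝ} (hε : 0 ≤ ε) (hf : AEStronglyMeasurable f (torusMeasure d))
    (hfε : ∀ x ∈ torus d, ‖f x - ∑ k ∈ Q, h k * trigSystem d k x‖ ≤ ε) {p : ℝ≥0∞} (hp2 : p ≤ 2) :
    eLpNorm f p (torusMeasure d) ≤ ENNReal.ofReal (√(∑ k ∈ Q, ‖h k‖ ^ 2) + ε) := by
  set T : (Fin d → ℝ) → ℂ := fun x => ∑ k ∈ Q, h k * trigSystem d k x with hT
  have hTc : Continuous T := continuous_finsetSum _ fun k _ =>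
    continuous_const.mul (continuous_trigSystem d k)
  have hTm : MemLp T 2 (torusMeasure d) :=
    (memLp_two_iff_integrable_sq_norm hTc.aestronglyMeasurable).2
      (integrable_of_continuous (hTc.norm.pow 2))
  have hT2 : eLpNorm T 2 (torusMeasure d) = ENNReal.ofReal (√(∑ k ∈ Q, ‖h k‖ ^ 2)) := by
    rw [hTm.eLpNorm_eq_integral_rpow_norm two_ne_zero ENNReal.ofNat_ne_top,
      ← integral_norm_sum_trigSystem_sq, Real.sqrt_eq_rpow]
    simp [hT]
  have hdiff : eLpNorm (f - T) 2 (torusMeasure d) ≤ ENNReal.ofReal ε := by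
    refine (eLpNorm_le_of_ae_bound (C := ε) ?_).trans (by simp)
    filter_upwards [ae_mem_torus d] with x hx using hfε x hx
  refine (eLpNorm_le_eLpNorm_of_exponent_le hp2 hf).trans ?_
  rw [ENNReal.ofReal_add (Real.sqrt_nonneg _) hε, ← hT2, add_comm]
  calc _ = eLpNorm ((f - T) + T) 2 (torusMeasure d) := by rw [sub_add_cancel]
    _ ≤ eLpNorm (f - T) 2 (torusMeasure d) + eLpNorm T 2 (torusMeasure d) :=
        eLpNorm_add_le (hf.sub hTc.aestronglyMeasurable) hTc.aestronglyMeasurable one_le_two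
    _ ≤ _ := by gcongr

/-- The `ℓ_2` bound for coefficients of functions that are small at norming points. -/
theorem sqrt_sum_sq_le {d n1 L : ℕ} {β S v ε : ℝ} (hβ0 : 0 < β) (hβ1 : β ≤ 1) (hS0 : 0 < S)
    (hv : 0 < v) (hvL : 9 * v ≤ 4 ^ L) {low : Finset (Fin d → ℤ)}
    (hlow : low ⊆ freqCube d (2 ^ n1)) (hcard : (#low : ℝ) ≤ v) {P : Finset (torus d)}
    (hP : ∀ c : (Fin d → ℤ) → ℂ, ∑ k ∈ freqCube d (2 ^ n1), ‖c k‖ ≤ 2 ^ L →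
        ∑ k ∈ freqCube d (2 ^ n1), ‖c k‖ ^ 2 = 1 →
        ∃ x ∈ P, 1 / 4 ≤ ‖∑ k ∈ freqCube d (2 ^ n1), c k * trigSystem d k x‖)
    {h : (Fin d → ℤ) → ℂ} (hS : ∑ k ∈ freqCube d (2 ^ n1) \ low, ‖h k‖ ^ β ≤ S)
    (hε0 : 0 ≤ ε) (hε : ∀ x ∈ P, ‖∑ k ∈ freqCube d (2 ^ n1), h k * trigSystem d k x‖ ≤ ε) :
    √(∑ k ∈ freqCube d (2 ^ n1), ‖h k‖ ^ 2) ≤ 4 * ε + S ^ (1 / β) * v ^ (1 / 2 - 1 / β) := by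
  classical
  set Q := freqCube d (2 ^ n1) with hQ
  set τ := √(∑ k ∈ Q, ‖h k‖ ^ 2) with hτ
  -- If `τ` exceeds the bound, the remainder in the ℓ_1 estimate is at most √v τ, so the ℓ_1 norm is
  -- at most 3√v τ ≤ 2^L τ. After division by `τ` the norming property gives τ/4 ≤ ε, a
  -- contradiction.
  by_contra! hcon
  have hR : 0 < S ^ (1 / β) * v ^ (1 / 2 - 1 / β) := by positivity
  have hτ0 : 0 < τ := by linarith
  have h1 := sum_le_sqrt_mul_add hβ0 hβ1 hS0 hv hlow hcard (fun k => norm_nonneg (h k)) hS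
  have h2 : S ^ (1 / β) * v ^ (1 - 1 / β) ≤ √v * τ := by
    have : v ^ (1 - 1 / β) = v ^ (1 / 2 - 1 / β) * √v := by
      rw [Real.sqrt_eq_rpow, ← Real.rpow_add hv]; congr 1; ring
    rw [this, ← mul_assoc, mul_comm]
    exact mul_le_mul_of_nonneg_left (by linarith) (Real.sqrt_nonneg _)
  have h3 : √(2 * v) + √v ≤ 2 ^ L := by
    have e1 : √(2 * v) ≤ 2 * √v := by
      rw [Real.sqrt_le_left (by positivity), mul_pow, Real.sq_sqrt hv.le]; linarith
    have e2 : 3 * √v ≤ 2 ^ L := by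
      refine le_of_sq_le_sq ?_ (by positivity)
      rw [mul_pow, Real.sq_sqrt hv.le, ← pow_mul, mul_comm L, pow_mul]
      norm_num
      exact hvL
    linarith
  have h4 : ∑ k ∈ Q, ‖h k‖ ≤ 2 ^ L * τ :=
    calc _ ≤ √(2 * v) * τ + √v * τ := by linarith
      _ = (√(2 * v) + √v) * τ := by ring
      _ ≤ _ := mul_le_mul_of_nonneg_right h3 hτ0.le
  have hn : ∀ k, ‖((τ⁻¹ : ℝ) : ℂ) * h k‖ = τ⁻¹ * ‖h k‖ := fun k => by
    rw [norm_mul, Complex.norm_real, Real.norm_of_nonneg (by positivity)]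
  obtain ⟨x, hx, hx'⟩ := hP (fun k => ((τ⁻¹ : ℝ) : ℂ) * h k) (by
    simp only [hn, ← mul_sum]
    rw [inv_mul_le_iff₀ hτ0]
    linarith) (by
    simp only [hn, mul_pow, ← mul_sum]
    have : τ ^ 2 = ∑ k ∈ Q, ‖h k‖ ^ 2 := Real.sq_sqrt (sum_nonneg fun _ _ => sq_nonneg _)
    rw [← this]
    field_simp)
  simp only [mul_assoc, ← mul_sum] at hx'
  rw [norm_mul, Complex.norm_real, Real.norm_of_nonneg (by positivity), ← div_eq_inv_mul,
    div_le_div_iff₀ (by norm_num) hτ0] at hx'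
  linarith [hε x hx]

/-- The least `L` with 9v ≤ 4^L satisfies 4^L ≤ 36v, so the number of points is 2^n up to a power of
n + 1. -/
theorem norming_points_count {d κ n : ℕ} :
    (Nat.clog 4 (9 * (2 ^ (n + d) * (n + 1) ^ d)) + 1) ^ 2 *
      4 ^ Nat.clog 4 (9 * (2 ^ (n + d) * (n + 1) ^ d)) * (8192 * ((κ * n + 1) * d + 3)) ^ 2 ≤
    (d + 3) ^ 2 * (36 * 2 ^ d) * (8192 * ((κ + 1) * d + 3)) ^ 2 * 2 ^ n * (n + 1) ^ (d + 4) := by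
  set v := 2 ^ (n + d) * (n + 1) ^ d with hv
  set L := Nat.clog 4 (9 * v) with hL
  have hv0 : 0 < v := by positivity
  have h1 : L + 1 ≤ (d + 3) * (n + 1) := by
    have : L ≤ 2 + (n + d) + n * d := by
      refine Nat.clog_le_of_le_pow ?_
      have e1 : (n + 1) ^ d ≤ 4 ^ (n * d) := by
        rw [pow_mul]
        refine Nat.pow_le_pow_left ?_ d
        exact (Nat.lt_pow_self (by norm_num : 1 < 4))
      calc 9 * v ≤ 4 ^ 2 * (4 ^ (n + d) * 4 ^ (n * d)) := by
            refine Nat.mul_le_mul (by norm_num) (Nat.mul_le_mul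
              (Nat.pow_le_pow_left (by norm_num) _) e1)
        _ = _ := by rw [pow_add, pow_add]; ring
    calc L + 1 ≤ 2 + (n + d) + n * d + 1 := by omega
      _ ≤ (d + 3) * (n + 1) := by nlinarith
  have h2 : 4 ^ L ≤ 36 * v := by
    have e1 : 4 ^ (L - 1) < 9 * v := Nat.pow_pred_clog_lt_self (by norm_num) (by omega)
    have e2 : 4 ^ L ≤ 4 * 4 ^ (L - 1) := by
      rw [← pow_succ']
      exact Nat.pow_le_pow_right (by norm_num) (by omega)
    omega
  have h3 : 8192 * ((κ * n + 1) * d + 3) ≤ 8192 * ((κ + 1) * d + 3) * (n + 1) := by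
    have : (κ * n + 1) * d + 3 ≤ ((κ + 1) * d + 3) * (n + 1) := by
      calc (κ * n + 1) * d + 3 ≤ (κ * n + 1) * d + 3 + (κ * d + n * d + 3 * n) :=
            Nat.le_add_right _ _
        _ = _ := by ring
    rw [mul_assoc]
    exact Nat.mul_le_mul_left _ this
  calc _ ≤ ((d + 3) * (n + 1)) ^ 2 * (36 * v) * (8192 * ((κ + 1) * d + 3) * (n + 1)) ^ 2 :=
        Nat.mul_le_mul (Nat.mul_le_mul (Nat.pow_le_pow_left h1 2) h2) (Nat.pow_le_pow_left h3 2)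
    _ = _ := by rw [hv]; ring

theorem exists_coeffs_sub {d : ℕ} {a b β : ℝ} (hβ0 : 0 < β) (hβ1 : β ≤ 1)
    {f g : (Fin d → ℝ) → ℂ} (hf : f ∈ classH (torus d) (trigSystem d) a b β)
    (hg : g ∈ classH (torus d) (trigSystem d) a b β) :
    ∃ h : (Fin d → ℤ) → ℂ, DiffBound a (((d : ℝ) - 1) * b) β h ∧
      ∀ x ∈ torus d, HasSum (fun k => h k * trigSystem d k x) ((f - g) x) := by
  obtain ⟨c, -, hcs, hcb⟩ := hf
  obtain ⟨c', -, hcs', hcb'⟩ := hg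
  refine ⟨c - c', diffBound_sub hβ0 hβ1 hcb hcb', fun x hx => ?_⟩
  simpa [sub_mul] using (hcs x hx).sub (hcs' x hx)

theorem torus_nonempty (d : ℕ) : Nonempty (torus d) :=
  ⟨⟨0, le_rfl, fun _ => by simp only [Pi.zero_apply]; positivity⟩⟩

theorem norm_sub_trigPoly_le {d : ℕ} {a γ β C : ℝ} {h : (Fin d → ℤ) → ℂ}
    (hC : ∀ h : (Fin d → ℤ) → ℂ, DiffBound a γ β h → ∀ (n : ℕ)
      (F : Finset (Fin d → ℤ)), (∀ k ∈ F, n ≤ ∑ j, blockIndex k j) →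
      ∑ k ∈ F, ‖h k‖ ≤ C * 2 ^ (-(a / 4) * (n : ℝ)))
    (hh : DiffBound a γ β h) {Q : Finset (Fin d → ℤ)} {n : ℕ}
    (hQ : ∀ k ∉ Q, n ≤ ∑ j, blockIndex k j) {x : Fin d → ℝ} {z : ℂ}
    (hz : HasSum (fun k => h k * trigSystem d k x) z) :
    ‖z - ∑ k ∈ Q, h k * trigSystem d k x‖ ≤ C * 2 ^ (-(a / 4) * (n : ℝ)) := by
  refine norm_sub_sum_le_of_hasSum hz fun F hF => ?_
  simp only [norm_mul, norm_trigSystem, mul_one]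
  exact hC h hh n F fun k hk => hQ k (disjoint_left.1 hF hk)

/-- Serves the finitely many `m` too small for level 0 of the main estimate. -/
theorem exists_trivial_upper_bound (d : ℕ) {a b β : ℝ} (ha : 0 < a) (hβ0 : 0 < β) (hβ1 : β ≤ 1) :
    ∃ C : ℝ, 0 < C ∧ ∀ (m : ℕ) (p : ℝ≥0∞), p ≤ 2 →
      recoveryH d a b β m p ≤ ENNReal.ofReal C := by
  obtain ⟨C, hC0, hC⟩ := exists_tail_bound d (((d : ℝ) - 1) * b) ha hβ0 hβ1
  refine ⟨C, hC0, fun m p hp => ?_⟩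
  have := torus_nonempty d
  refine optimalRecovery_le (fun f hf => memLp_of_mem_classH hf p)
    (fun _ => Classical.arbitrary _) fun f hf g hg _ => ?_
  obtain ⟨h, hh, hsum⟩ := exists_coeffs_sub hβ0 hβ1 hf hg
  have := eLpNorm_le_of_approx (h := h) (Q := ∅) (ε := C) hC0.le
    ((memLp_of_mem_classH hf p).1.sub (memLp_of_mem_classH hg p).1) (fun x hx => by
      simpa using norm_sub_trigPoly_le hC hh (Q := ∅) (n := 0) (fun _ _ => Nat.zero_le _)
        (hsum x hx)) hp
  simpa using this

theorem exists_upper_bound (d : ℕ) {a b β : ℝ} (ha : 0 < a) (hβ0 : 0 < β) (hβ1 : β ≤ 1) :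
    ∃ (C₀ K : ℕ) (C E : ℝ), 0 < C₀ ∧ 0 < C ∧ 0 ≤ E ∧ ∀ n m : ℕ, C₀ * 2 ^ n * (n + 1) ^ K ≤ m →
      ∀ p : ℝ≥0∞, p ≤ 2 → recoveryH d a b β m p ≤
        ENNReal.ofReal (C * 2 ^ (-(a + 1 / β - 1 / 2) * n) * ((n : ℝ) + 1) ^ E) := by
  classical
  set δ := a + 1 / β - 1 / 2 with hδ
  set γ := ((d : ℝ) - 1) * b with hγ
  have hβi : 1 ≤ 1 / β := by rw [le_div_iff₀ hβ0]; linarith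
  obtain ⟨C, hC0, hC⟩ := exists_tail_bound d γ ha hβ0 hβ1
  -- The cube is cut at 2^(κn) so that the tail 2^(-(a/4)κn) is at most 2^(-δn); since `κ` is fixed,
  -- the logarithm of its cardinality stays linear in `n`.
  obtain ⟨κ, hκ⟩ := exists_nat_ge (4 * δ / a)
  have hκδ : δ ≤ a / 4 * κ := by
    rw [div_le_iff₀ ha] at hκ; linarith
  set K₁ : ℝ := ((κ : ℝ) + 1) ^ d with hK₁
  set K₂ : ℝ := ((d : ℝ) * κ + 1) ^ |γ| with hK₂
  set E : ℝ := d * (1 / β) + |γ| with hE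
  have hE0 : 0 ≤ E := by positivity
  refine ⟨(d + 3) ^ 2 * (36 * 2 ^ d) * (8192 * ((κ + 1) * d + 3)) ^ 2, d + 4,
    5 * C + (2 * K₁) ^ (1 / β) * K₂, E, by positivity, by positivity, hE0,
    fun n m hm p hp => ?_⟩
  set n1 := κ * n with hn1
  set v : ℕ := 2 ^ (n + d) * (n + 1) ^ d with hv
  set L := Nat.clog 4 (9 * v) with hL
  obtain ⟨P, hPcard, hP⟩ := exists_trig_norming_points d n1 L
  have hPm : #P ≤ m := hPcard.trans (norming_points_count.trans hm)
  have := torus_nonempty d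
  obtain ⟨ξ, hξ⟩ := exists_map_covering P hPm
  refine optimalRecovery_le (fun f hf => memLp_of_mem_classH hf p) ξ fun f hf g hg hfg => ?_
  obtain ⟨h, hh, hsum⟩ := exists_coeffs_sub hβ0 hβ1 hf hg
  set ε := C * 2 ^ (-(a / 4) * (n1 : ℝ)) with hε
  have hε0 : 0 ≤ ε := by positivity
  have happ : ∀ x ∈ torus d,
      ‖(f - g) x - ∑ k ∈ freqCube d (2 ^ n1), h k * trigSystem d k x‖ ≤ ε := fun x hx =>
    norm_sub_trigPoly_le hC hh (fun k hk => by
      rw [mem_freqCube] at hk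
      push Not at hk
      obtain ⟨j, hj⟩ := hk
      have h1 : ¬ (k j).natAbs.size ≤ n1 := by
        rw [← abs_lt_two_pow_iff, not_lt]; exact_mod_cast hj
      exact (not_le.1 h1).le.trans (single_le_sum (f := fun j => blockIndex k j)
        (fun _ _ => Nat.zero_le _) (mem_univ j))) (hsum x hx)
  refine (eLpNorm_le_of_approx hε0 ((memLp_of_mem_classH hf p).1.sub
    (memLp_of_mem_classH hg p).1) happ hp).trans (ENNReal.ofReal_le_ofReal ?_)
  have hn0 : (0 : ℝ) < (n : ℝ) + 1 := by positivity
  have hn1' : (1 : ℝ) ≤ (n : ℝ) + 1 := by linarith [(Nat.cast_nonneg n : (0 : ℝ) ≤ n)]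
  set S : ℝ := K₁ * ((n : ℝ) + 1) ^ d *
    (2 * (2 ^ (-a * (n : ℝ)) * (K₂ * ((n : ℝ) + 1) ^ |γ|)) ^ β) with hS
  have hS0 : 0 < S := by positivity
  have hhigh := (sum_high_le ha hβ0 hh n n1).trans (show _ ≤ S by
    have e1 : (n1 : ℝ) + 1 ≤ (κ + 1) * (n + 1) := by
      rw [hn1]; push_cast; nlinarith [(Nat.cast_nonneg κ : (0 : ℝ) ≤ κ)]
    have e2 : (d : ℝ) * n1 + 1 ≤ (d * κ + 1) * (n + 1) := by
      rw [hn1]; push_cast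
      nlinarith [(Nat.cast_nonneg n : (0 : ℝ) ≤ n),
        mul_nonneg (Nat.cast_nonneg (α := ℝ) d) (Nat.cast_nonneg (α := ℝ) κ)]
    rw [hS, hK₁, hK₂, ← mul_pow, ← Real.mul_rpow (by positivity) (by positivity)]
    gcongr)
  have hvn : (2 : ℝ) ^ (n : ℝ) ≤ v := by
    rw [Real.rpow_natCast, hv]
    have : 2 ^ n ≤ 2 ^ (n + d) * (n + 1) ^ d :=
      (Nat.pow_le_pow_right two_pos (Nat.le_add_right n d)).trans
        (Nat.le_mul_of_pos_right _ (by positivity))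
    exact_mod_cast this
  have hmain := sqrt_sum_sq_le (v := v) (ε := ε) hβ0 hβ1 hS0 (by positivity)
    (by exact_mod_cast Nat.le_pow_clog (by norm_num) (9 * v)) (filter_subset _ _)
    (by exact_mod_cast card_low_le d n n1) hP hhigh hε0 (fun x hx => by
      obtain ⟨i, hi⟩ := hξ x hx
      have h1 := happ x x.2
      rw [Pi.sub_apply, ← hi, hfg i, sub_self, zero_sub, norm_neg, hi] at h1
      exact h1)
  have hεle : ε ≤ C * 2 ^ (-δ * (n : ℝ)) * ((n : ℝ) + 1) ^ E := by
    have h1 : (2 : ℝ) ^ (-(a / 4) * (n1 : ℝ)) ≤ 2 ^ (-δ * (n : ℝ)) := by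
      refine Real.rpow_le_rpow_of_exponent_le one_le_two ?_
      rw [hn1]; push_cast
      nlinarith [(Nat.cast_nonneg n : (0 : ℝ) ≤ n)]
    calc ε ≤ C * 2 ^ (-δ * (n : ℝ)) := mul_le_mul_of_nonneg_left h1 hC0.le
      _ ≤ _ := le_mul_of_one_le_right (by positivity) (Real.one_le_rpow hn1' hE0)
  have hSβ : S ^ (1 / β) = (2 * K₁) ^ (1 / β) * K₂ * 2 ^ (-a * (n : ℝ)) * ((n : ℝ) + 1) ^ E := by
    have h1 : S = (2 * K₁) * ((n : ℝ) + 1) ^ d *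
        (2 ^ (-a * (n : ℝ)) * (K₂ * ((n : ℝ) + 1) ^ |γ|)) ^ β := by rw [hS]; ring
    rw [h1, Real.mul_rpow (by positivity) (by positivity),
      Real.mul_rpow (by positivity) (by positivity), ← Real.rpow_mul (by positivity),
      mul_one_div_cancel hβ0.ne', Real.rpow_one, ← Real.rpow_natCast, ← Real.rpow_mul hn0.le, hE,
      Real.rpow_add hn0]
    ring
  have hSv : S ^ (1 / β) * (v : ℝ) ^ (1 / 2 - 1 / β) ≤
      (2 * K₁) ^ (1 / β) * K₂ * 2 ^ (-δ * (n : ℝ)) * ((n : ℝ) + 1) ^ E := by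
    -- The exponent is negative, so the logarithmic excess of `v` over 2^n only helps.
    have h1 : (v : ℝ) ^ (1 / 2 - 1 / β) ≤ 2 ^ ((n : ℝ) * (1 / 2 - 1 / β)) := by
      rw [Real.rpow_mul two_pos.le]
      exact Real.rpow_le_rpow_of_nonpos (by positivity) hvn (by linarith)
    have h2 : (2 : ℝ) ^ (-δ * (n : ℝ)) = 2 ^ (-a * (n : ℝ)) * 2 ^ ((n : ℝ) * (1 / 2 - 1 / β)) := by
      rw [← Real.rpow_add two_pos]; congr 1; rw [hδ]; ring
    rw [hSβ, h2]
    calc _ ≤ (2 * K₁) ^ (1 / β) * K₂ * 2 ^ (-a * (n : ℝ)) * ((n : ℝ) + 1) ^ E *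
          2 ^ ((n : ℝ) * (1 / 2 - 1 / β)) := mul_le_mul_of_nonneg_left h1 (by positivity)
      _ = _ := by ring
  calc _ ≤ 4 * ε + S ^ (1 / β) * (v : ℝ) ^ (1 / 2 - 1 / β) + ε := by linarith
    _ ≤ 5 * (C * 2 ^ (-δ * (n : ℝ)) * ((n : ℝ) + 1) ^ E) +
        (2 * K₁) ^ (1 / β) * K₂ * 2 ^ (-δ * (n : ℝ)) * ((n : ℝ) + 1) ^ E := by linarith
    _ = _ := by ring

/-! ### From dyadic levels to the number of points m -/

theorem two_rpow_log_le {m : ℕ} (hm : m ≠ 0) : (2 : ℝ) ^ (Nat.log 2 m) ≤ m := by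
  exact_mod_cast Nat.pow_log_le_self 2 hm

theorem log_two_mul_log_le {m : ℕ} (hm : m ≠ 0) : (Nat.log 2 m : ℝ) * Real.log 2 ≤ Real.log m := by
  rw [← Real.log_pow]
  exact Real.log_le_log (by positivity) (two_rpow_log_le hm)

theorem nat_log_add_two_le {m : ℕ} (hm : 2 ≤ m) :
    (Nat.log 2 m : ℝ) + 2 ≤ 3 / Real.log 2 * Real.log m := by
  have h0 : 0 < Real.log 2 := Real.log_pos one_lt_two
  have h1 := log_two_mul_log_le (m := m) (by omega)
  have h2 : Real.log 2 ≤ Real.log m := Real.log_le_log two_pos (by exact_mod_cast hm)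
  rw [div_mul_eq_mul_div, le_div_iff₀ h0]
  linarith

theorem log_le_nat_log_add_two {m : ℕ} (hm : 2 ≤ m) : Real.log m ≤ (Nat.log 2 m : ℝ) + 2 := by
  have h1 : (m : ℝ) ≤ 2 ^ (Nat.log 2 m + 1) := by
    exact_mod_cast (Nat.lt_pow_succ_log_self one_lt_two m).le
  have h2 := Real.log_le_log (by positivity) h1
  rw [Real.log_pow] at h2
  have h3 : Real.log 2 < 1 := Real.log_two_lt_d9.trans (by norm_num)
  push_cast at h2
  nlinarith [(Nat.cast_nonneg (Nat.log 2 m) : (0 : ℝ) ≤ _)]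

theorem exists_lower_rate (d : ℕ) (hd : 1 ≤ d) (a b β : ℝ) (ha : 0 < a) (hβ0 : 0 < β)
    (hβ1 : β ≤ 1) :
    ∃ c : ℝ, 0 < c ∧ ∀ p : ℝ≥0∞, 1 ≤ p → ∀ m : ℕ, 1 ≤ m →
      ENNReal.ofReal (c * (m : ℝ) ^ (1 / 2 - 1 / β - a) *
          Real.log m ^ (((d : ℝ) - 1) * (b + 1))) ≤ recoveryH d a b β m p := by
  obtain ⟨c, hc0, hc⟩ := exists_lower_bound d hd a b β ha hβ0 hβ1
  set δ := a + 1 / β - 1 / 2 with hδ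
  set g := ((d : ℝ) - 1) * (b + 1) with hg
  have hβi : 1 ≤ 1 / β := by rw [le_div_iff₀ hβ0]; linarith
  have hδ0 : 0 < δ := by linarith
  have hl2 : 0 < Real.log 2 := Real.log_pos one_lt_two
  have hl2' : Real.log 2 < 1 := Real.log_two_lt_d9.trans (by norm_num)
  set Λ := 3 / Real.log 2 with hΛ
  have hΛ1 : 1 ≤ Λ := by rw [hΛ, le_div_iff₀ hl2]; linarith
  have hΛ0 : 0 < Λ := by linarith
  refine ⟨c * 4 ^ (-δ) * Λ ^ (-|g|), by positivity, fun p hp m hm => ?_⟩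
  have hmR : (0 : ℝ) < m := by exact_mod_cast hm
  set k := Nat.log 2 m with hk
  have h2k := two_rpow_log_le (m := m) (by omega)
  -- Level k + 2 gives 2m ≤ 2^(k+2) ≤ 4m: enough dimensions for fooling, at the cost of a factor
  -- 4^(-δ).
  have hmain := hc m (k + 2) (by omega) (by
    have := (Nat.lt_pow_succ_log_self one_lt_two m).le
    rw [← hk] at this
    rw [pow_succ]
    omega) p hp
  refine le_trans (ENNReal.ofReal_le_ofReal ?_) hmain
  have hm4 : (4 : ℝ) ^ (-δ) * (m : ℝ) ^ (1 / 2 - 1 / β - a) ≤ 2 ^ (-δ * ((k + 2 : ℕ) : ℝ)) := by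
    have e1 : (1 / 2 - 1 / β - a) = -δ := by rw [hδ]; ring
    rw [e1, ← Real.mul_rpow (by norm_num) hmR.le, mul_comm (-δ), Real.rpow_mul two_pos.le,
      Real.rpow_natCast]
    refine Real.rpow_le_rpow_of_nonpos (by positivity) ?_ (by linarith)
    rw [pow_add]
    linarith
  have hlog : Λ ^ (-|g|) * Real.log m ^ g ≤ ((k + 2 : ℕ) : ℝ) ^ g := by
    rcases hm.eq_or_lt with h1 | h1
    -- For m = 1 the base is 0: with g = 0 the power is 1, and otherwise, even for negative `g`,
    -- `Real.rpow` gives 0 and the claim is trivial.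
    · rw [← h1, Nat.cast_one, Real.log_one]
      by_cases hg0 : g = 0
      · rw [hg0]; simp
      · rw [Real.zero_rpow hg0, mul_zero]; positivity
    · have hl : 0 < Real.log m := Real.log_pos (by exact_mod_cast h1)
      have h3 := nat_log_add_two_le h1
      have h4 := log_le_nat_log_add_two h1
      have h5 : ((k + 2 : ℕ) : ℝ) = (((k : ℝ) + 2) / Real.log m) * Real.log m := by
        push_cast; field_simp
      have h6 : 1 ≤ ((k : ℝ) + 2) / Real.log m := by rwa [le_div_iff₀ hl, one_mul]
      have h7 : ((k : ℝ) + 2) / Real.log m ≤ Λ := by rwa [div_le_iff₀ hl]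
      rw [h5, Real.mul_rpow (by positivity) hl.le]
      refine mul_le_mul_of_nonneg_right ?_ (by positivity)
      -- The ratio of k + 2 to log m lies in [1, Λ], so this covers both signs of `g`.
      calc Λ ^ (-|g|) ≤ (((k : ℝ) + 2) / Real.log m) ^ (-|g|) :=
            Real.rpow_le_rpow_of_nonpos (by positivity) h7 (by simp)
        _ ≤ _ := Real.rpow_le_rpow_of_exponent_le h6 (neg_abs_le g)
  calc _ = c * (4 ^ (-δ) * (m : ℝ) ^ (1 / 2 - 1 / β - a)) * (Λ ^ (-|g|) * Real.log m ^ g) := by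
        ring
    _ ≤ c * 2 ^ (-δ * ((k + 2 : ℕ) : ℝ)) * ((k + 2 : ℕ) : ℝ) ^ g := by
        refine mul_le_mul (mul_le_mul_of_nonneg_left hm4 hc0.le) hlog ?_ (by positivity)
        have : 0 ≤ Real.log m := Real.log_natCast_nonneg m
        positivity

theorem exists_upper_rate (d : ℕ) (a b β : ℝ) (ha : 0 < a) (hβ0 : 0 < β) (hβ1 : β ≤ 1) :
    ∃ C K : ℝ, 0 < C ∧ ∀ p : ℝ≥0∞, p ≤ 2 → ∀ m : ℕ, 2 ≤ m →
      recoveryH d a b β m p ≤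
        ENNReal.ofReal (C * (m : ℝ) ^ (1 / 2 - 1 / β - a) * Real.log m ^ K) := by
  obtain ⟨C₀, K₀, C₁, E, hC₀, hC₁, hE, hup⟩ := exists_upper_bound d (b := b) ha hβ0 hβ1
  obtain ⟨C₂, hC₂, htriv⟩ := exists_trivial_upper_bound d (b := b) ha hβ0 hβ1
  set δ := a + 1 / β - 1 / 2 with hδ
  have hβi : 1 ≤ 1 / β := by rw [le_div_iff₀ hβ0]; linarith
  have hδ0 : 0 < δ := by linarith
  have he : (1 / 2 - 1 / β - a) = -δ := by rw [hδ]; ring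
  have hl2 : 0 < Real.log 2 := Real.log_pos one_lt_two
  set Λ := 3 / Real.log 2 with hΛ
  have hΛ0 : 0 < Λ := by positivity
  have hC₀R : (0 : ℝ) < C₀ := by exact_mod_cast hC₀
  set K : ℝ := K₀ * δ + E with hK
  have hK0 : 0 ≤ K := by positivity
  set D₁ : ℝ := C₁ * (2 * C₀) ^ δ * Λ ^ K with hD₁
  set D₂ : ℝ := C₂ * C₀ ^ δ * (Real.log 2 ^ K)⁻¹ with hD₂
  have hD₁0 : 0 < D₁ := by positivity
  have hD₂0 : 0 < D₂ := by positivity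
  refine ⟨D₁ + D₂, K, by positivity, fun p hp m hm => ?_⟩
  have hmR : (0 : ℝ) < m := by
    have : 0 < m := by omega
    exact_mod_cast this
  have hlm : Real.log 2 ≤ Real.log m := Real.log_le_log two_pos (by exact_mod_cast hm)
  have hlm0 : 0 < Real.log m := by linarith
  rw [he]
  by_cases hC₀m : C₀ ≤ m
  -- The largest level that `m` points can afford. Maximality bounds `m` by 2^n times (log m)^K₀, up
  -- to constants, which is where the summand K₀δ of `K` comes from.
  · set n := Nat.findGreatest (fun n => C₀ * 2 ^ n * (n + 1) ^ K₀ ≤ m) m with hn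
    have hsp : C₀ * 2 ^ n * (n + 1) ^ K₀ ≤ m :=
      Nat.findGreatest_spec (P := fun n => C₀ * 2 ^ n * (n + 1) ^ K₀ ≤ m) (Nat.zero_le m)
        (by simpa using hC₀m)
    have h2n : 2 ^ n ≤ m := by
      refine le_trans ?_ hsp
      calc 2 ^ n ≤ C₀ * 2 ^ n := Nat.le_mul_of_pos_left _ hC₀
        _ ≤ _ := Nat.le_mul_of_pos_right _ (by positivity)
    have hgt : m < C₀ * 2 ^ (n + 1) * (n + 1 + 1) ^ K₀ := by
      have h1 : n + 1 ≤ m := (Nat.lt_two_pow_self (n := n)).trans_le h2n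
      have := Nat.findGreatest_is_greatest (P := fun n => C₀ * 2 ^ n * (n + 1) ^ K₀ ≤ m)
        (Nat.lt_succ_self n) h1
      exact not_le.1 this
    have hn2 : (n : ℝ) + 2 ≤ Λ * Real.log m := by
      have h1 : n ≤ Nat.log 2 m := Nat.le_log_of_pow_le one_lt_two h2n
      have h2 : (n : ℝ) ≤ Nat.log 2 m := by exact_mod_cast h1
      exact (by linarith : (n : ℝ) + 2 ≤ Nat.log 2 m + 2).trans (nat_log_add_two_le hm)
    have hgtR : (m : ℝ) ≤ 2 * C₀ * (Λ * Real.log m) ^ K₀ * 2 ^ (n : ℝ) := by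
      have h1 : (m : ℝ) ≤ C₀ * 2 ^ (n + 1) * ((n : ℝ) + 1 + 1) ^ K₀ := by exact_mod_cast hgt.le
      have h2 : ((n : ℝ) + 1 + 1) ^ K₀ ≤ (Λ * Real.log m) ^ K₀ :=
        pow_le_pow_left₀ (by positivity) (by linarith) _
      calc (m : ℝ) ≤ C₀ * 2 ^ (n + 1) * ((n : ℝ) + 1 + 1) ^ K₀ := h1
        _ ≤ C₀ * 2 ^ (n + 1) * (Λ * Real.log m) ^ K₀ :=
            mul_le_mul_of_nonneg_left h2 (by positivity)
        _ = _ := by rw [Real.rpow_natCast, pow_succ]; ring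
    have hpow : (2 : ℝ) ^ (-δ * (n : ℝ)) ≤
        (2 * C₀) ^ δ * (Λ * Real.log m) ^ (K₀ * δ) * (m : ℝ) ^ (-δ) := by
      have h1 := Real.rpow_le_rpow hmR.le hgtR hδ0.le
      rw [Real.mul_rpow (by positivity) (by positivity),
        Real.mul_rpow (by positivity) (by positivity), ← Real.rpow_natCast (Λ * Real.log m),
        ← Real.rpow_mul (by positivity), ← Real.rpow_mul two_pos.le, mul_comm (n : ℝ)] at h1
      rw [neg_mul, Real.rpow_neg two_pos.le, Real.rpow_neg hmR.le, ← div_eq_mul_inv,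
        le_div_iff₀ (by positivity), inv_mul_le_iff₀ (by positivity)]
      linarith
    have hnE : ((n : ℝ) + 1) ^ E ≤ (Λ * Real.log m) ^ E :=
      Real.rpow_le_rpow (by positivity) (by linarith) hE
    refine (hup n m hsp p hp).trans (ENNReal.ofReal_le_ofReal ?_)
    calc C₁ * 2 ^ (-δ * (n : ℝ)) * ((n : ℝ) + 1) ^ E
        ≤ C₁ * ((2 * C₀) ^ δ * (Λ * Real.log m) ^ (K₀ * δ) * (m : ℝ) ^ (-δ)) *
          (Λ * Real.log m) ^ E :=
          mul_le_mul (mul_le_mul_of_nonneg_left hpow hC₁.le) hnE (by positivity) (by positivity)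
      _ = C₁ * (2 * C₀) ^ δ * ((Λ * Real.log m) ^ (K₀ * δ) * (Λ * Real.log m) ^ E) *
          (m : ℝ) ^ (-δ) := by ring
      _ = D₁ * (m : ℝ) ^ (-δ) * Real.log m ^ K := by
          rw [← Real.rpow_add (by positivity), ← hK, Real.mul_rpow hΛ0.le hlm0.le, hD₁]; ring
      _ ≤ _ := by
          refine mul_le_mul_of_nonneg_right (mul_le_mul_of_nonneg_right ?_ ?_) ?_ <;>
            first | positivity | linarith
  · have hmC : (m : ℝ) ≤ C₀ := by exact_mod_cast (not_le.1 hC₀m).le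
    refine (htriv m p hp).trans (ENNReal.ofReal_le_ofReal ?_)
    have h1 : 1 ≤ (C₀ : ℝ) ^ δ * (m : ℝ) ^ (-δ) := by
      rw [Real.rpow_neg hmR.le, ← div_eq_mul_inv, one_le_div (by positivity)]
      exact Real.rpow_le_rpow hmR.le hmC hδ0.le
    have h2 : 1 ≤ (Real.log 2 ^ K)⁻¹ * Real.log m ^ K := by
      rw [inv_mul_eq_div, one_le_div (by positivity)]
      exact Real.rpow_le_rpow hl2.le hlm hK0
    calc C₂ ≤ C₂ * (((C₀ : ℝ) ^ δ * (m : ℝ) ^ (-δ)) * ((Real.log 2 ^ K)⁻¹ * Real.log m ^ K)) :=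
          le_mul_of_one_le_right hC₂.le (one_le_mul_of_one_le_of_one_le h1 h2)
      _ = D₂ * (m : ℝ) ^ (-δ) * Real.log m ^ K := by rw [hD₂]; ring
      _ ≤ _ := by
          refine mul_le_mul_of_nonneg_right (mul_le_mul_of_nonneg_right ?_ ?_) ?_ <;>
            first | positivity | linarith

end SamplingRecovery

theorem mainTheorem6 (d : ℕ) (hd : 1 ≤ d) (a b β : ℝ) (ha : 0 < a) (hβ0 : 0 < β) (hβ1 : β ≤ 1) :
    (∃ c : ℝ, 0 < c ∧ ∀ m : ℕ, 1 ≤ m →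
      ENNReal.ofReal (c * (m : ℝ) ^ (1 / 2 - 1 / β - a) *
          Real.log m ^ (((d : ℝ) - 1) * (b + 1))) ≤
        SamplingRecovery.recoveryH d a b β m 1) ∧
    (∃ c C K : ℝ, 0 < c ∧ 0 < C ∧ ∀ p : ENNReal, 1 ≤ p → p ≤ 2 → ∀ m : ℕ, 2 ≤ m →
      ENNReal.ofReal (c * (m : ℝ) ^ (1 / 2 - 1 / β - a) *
          Real.log m ^ (((d : ℝ) - 1) * (b + 1))) ≤
        SamplingRecovery.recoveryH d a b β m p ∧
      SamplingRecovery.recoveryH d a b β m p ≤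
        ENNReal.ofReal (C * (m : ℝ) ^ (1 / 2 - 1 / β - a) * Real.log m ^ K)) := by
  obtain ⟨c, hc0, hc⟩ := SamplingRecovery.exists_lower_rate d hd a b β ha hβ0 hβ1
  obtain ⟨C, K, hC0, hC⟩ := SamplingRecovery.exists_upper_rate d a b β ha hβ0 hβ1
  exact ⟨⟨c, hc0, fun m hm => hc 1 le_rfl m hm⟩, c, C, K, hc0, hC0,
    fun p hp1 hp2 m hm => ⟨hc p hp1 m (by omega), hC p hp2 m hm⟩⟩
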